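/- Let $n\ge 2$, $0\le d\le n$ and $\gamma>0$. Let $\widetilde G^n_d$ be the oriented Grassmannian of oriented $d$-dimensional linear subspaces of $\mathbb R^n$ (classes of linearly independent frames $(u_1,\dots,u_d)$ modulo matrices of positive determinant), and let $\mathcal V_d$ be the set of oriented $d$-varifolds, i.e. of finite nonnegative Borel measures on $\mathbb R^n\times\widetilde G^n_d$. The weight of $\mu\in\mathcal V_d$ is the measure $|\mu|(A)=\mu(A\times\widetilde G^n_d)$ on $\mathbb R^n$. For a $C^1$-diffeomorphism $\phi$ of $\mathbb R^n$, the pushforward $\phi_\#\mu$ is defined by $$\int\omega\,d(\phi_\#\mu)=\int\omega(\phi(x),d_x\phi\cdot U)\,J_U\phi(x)\,d\mu(x,U),$$ where $d_x\phi\cdot U$ is the oriented space spanned by $(d_x\phi(u_1),\dots,d_x\phi(u_d))$ for a frame $(u_i)$ of $U$, and $J_U\phi(x)=\sqrt{\det(d_x\phi(u_i)\cdot d_x\phi(u_j))_{i,j}}$ for an orthonormal frame $(u_i)$ of $U$. Let $V$ be a Hilbert space of vector fields on $\mathbb R^n$ that is continuously embedded in $C^2_0(\mathbb R^n,\mathbb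 R^n)$, the space of $C^2$ vector fields that vanish at infinity together with their first and second derivatives, with the sup-norm of the field and its derivatives up to order $2$. For $v\in L^2([0,1],V)$ let $\varphi^v_t$ be its flow, $\varphi^v_t(x)=x+\int_0^t v_s(\varphi^v_s(x))\,ds$; each $\varphi^v_t$ is a $C^1$-diffeomorphism. For $\mu\in\mathcal V_d$ and $\eta\in L^2([0,1],L^2(|\mu|))$ let $\tilde\alpha^\eta_t(x)=1+\frac12\int_0^t\eta_s(x)\,ds$. Call $(v,\eta)\in L^2([0,1],V\times L^2(|\mu|))$ admissible for $\mu$ if, for $|\mu|$-a.e. $x$, $\tilde\alpha^\eta_t(x)>0$ for all $t\in[0,1]$; it then joins $\mu$ to $$\big((\tilde\alpha^\eta_1)^2\circ(\varphi^v_1)^{-1}\big)\,(\varphi^v_1)_\#\mu .$$ The orbit $\Theta(\mu)$ is the set of all varifolds to which $\mu$ is joined by some admissible $(v,\eta)$. Let $$C_\mu(v,\eta)=\frac12\int_0^1\|v_t\|_V^2\,dt+\frac\gamma2\int_0^1\int_{\mathbb R^n}\eta_t^2\circ(\varphi^v_t)^{-1}\,d|(\varphi^v_t)_\#\mu|\,dt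 ,$$ and for $\mu,\mu'\in\mathcal V_d$ let $$d_{V\text{-}\mathcal{FR}}(\mu,\mu')^2=\inf C_\mu(v,\eta),$$ the infimum being taken over all $(v,\eta)$ that are admissible for $\mu$ and join $\mu$ to $\mu'$ (with $\inf\emptyset=+\infty$). Theorem. For every $\mu_0\in\mathcal V_d$, the function $d_{V\text{-}\mathcal{FR}}$ is a distance on $\Theta(\mu_0)$: for all $\mu,\mu',\mu''\in\Theta(\mu_0)$, 1. $d_{V\text{-}\mathcal{FR}}(\mu,\mu')<\infty$; 2. $d_{V\text{-}\mathcal{FR}}(\mu,\mu')=d_{V\text{-}\mathcal{FR}}(\mu',\mu)$; 3. $d_{V\text{-}\mathcal{FR}}(\mu,\mu'')\le d_{V\text{-}\mathcal{FR}}(\mu,\mu')+d_{V\text{-}\mathcal{FR}}(\mu',\mu'')$; 4. $d_{V\text{-}\mathcal{FR}}(\mu,\mu')=0$ if and only if $\mu=\mu'$. -/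

import Mathlib

open MeasureTheory Set Filter Topology
open scoped ENNReal

noncomputable section

namespace LddmmFR

/-- The ambient Euclidean space. -/
abbrev E (n : ℕ) := EuclideanSpace ℝ (Fin n)

/-! ### The oriented Grassmannian -/

/-- Frames: linearly independent `d`-tuples of vectors. -/
abbrev Frame (n d : ℕ) := {u : Fin d → E n // LinearIndependent ℝ u}

/-- Two frames span the same oriented subspace iff they are related by a
matrix of positive determinant. -/
def SameOriented {n d : ℕ} (u w : Fin d → E n) : Prop :=
  ∃ A : Matrix (Fin d) (Fin d) ℝ, 0 < A.det ∧ ∀ i, w i = ∑ j, A i j • u j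

theorem sameOriented_comp {n d : ℕ} {A B : Matrix (Fin d) (Fin d) ℝ} {u w z : Fin d → E n}
    (hA : ∀ i, w i = ∑ j, A i j • u j) (hB : ∀ i, z i = ∑ j, B i j • w j) (i : Fin d) :
    z i = ∑ j, (B * A) i j • u j := by
  rw [hB i]
  simp only [hA, Finset.smul_sum, smul_smul, Matrix.mul_apply, Finset.sum_smul]
  exact Finset.sum_comm

instance frameSetoid (n d : ℕ) : Setoid (Frame n d) where
  r u w := SameOriented u.1 w.1
  iseqv :=
    { refl := fun u => ⟨1, by simp, fun i => by simp [Matrix.one_apply]⟩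
      symm := by
        rintro u w ⟨A, hA, h⟩
        have hu : IsUnit A.det := hA.ne'.isUnit
        refine ⟨A⁻¹, ?_, fun i => ?_⟩
        · rw [Matrix.det_nonsing_inv, Ring.inverse_eq_inv']
          exact inv_pos.mpr hA
        · have h2 := sameOriented_comp (z := fun i => ∑ j, A⁻¹ i j • w.1 j) h (fun _ => rfl) i
          rw [Matrix.nonsing_inv_mul A hu] at h2
          simpa [Matrix.one_apply] using h2.symm
      trans := by
        rintro u w z ⟨A, hA, h⟩ ⟨B, hB, h'⟩
        exact ⟨B * A, by rw [Matrix.det_mul]; exact mul_pos hB hA, sameOriented_comp h h'⟩ }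

/-- The oriented Grassmannian of oriented `d`-dimensional linear subspaces of `ℝⁿ`. -/
def OrientedGrassmannian (n d : ℕ) : Type := Quotient (frameSetoid n d)

/-- The usual topology, as the quotient of the (open) set of frames. -/
instance (n d : ℕ) : TopologicalSpace (OrientedGrassmannian n d) :=
  inferInstanceAs (TopologicalSpace (Quotient (frameSetoid n d)))

instance (n d : ℕ) : MeasurableSpace (OrientedGrassmannian n d) := borel _

instance (n d : ℕ) : BorelSpace (OrientedGrassmannian n d) := ⟨rfl⟩

theorem sameOriented_map {n d : ℕ} (L : E n →L[ℝ] E n) {u w : Fin d → E n}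
    (h : SameOriented u w) : SameOriented (fun i => L (u i)) (fun i => L (w i)) := by
  obtain ⟨A, hA, h⟩ := h
  exact ⟨A, hA, fun i => by simp [h i]⟩

open Classical in
/-- The oriented subspace `L · U`, spanned by the image under `L` of a frame of `U`.
Only injective `L` matter; the value for other `L` is a placeholder. -/
def transport {n d : ℕ} (L : E n →L[ℝ] E n) (U : OrientedGrassmannian n d) :
    OrientedGrassmannian n d :=
  if hL : Function.Injective L then
    Quotient.map (sa := frameSetoid n d) (sb := frameSetoid n d)
      (fun u : Frame n d => (⟨fun i => L (u.1 i),
        u.2.map' (L : E n →ₗ[ℝ] E n) (LinearMap.ker_eq_bot.mpr hL)⟩ : Frame n d))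
      (fun _ _ h => sameOriented_map L h) U
  else U

/-- The `d`-volume of the parallelepiped spanned by a tuple of vectors. -/
def frameVolume {n d : ℕ} (u : Fin d → E n) : ℝ :=
  Real.sqrt (Matrix.gram ℝ u).det

theorem frameVolume_comp {n d : ℕ} {A : Matrix (Fin d) (Fin d) ℝ} {u w : Fin d → E n}
    (h : ∀ i, w i = ∑ j, A i j • u j) : frameVolume w = |A.det| * frameVolume u := by
  have hg : Matrix.gram ℝ w = A * Matrix.gram ℝ u * A.transpose := by
    ext i j
    simp only [Matrix.gram_apply, Matrix.mul_apply, Matrix.transpose_apply, h, sum_inner,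
      inner_sum, real_inner_smul_left, real_inner_smul_right, Finset.sum_mul]
    exact Finset.sum_congr rfl fun k _ => Finset.sum_congr rfl fun l _ => by ring
  rw [frameVolume, frameVolume, hg, Matrix.det_mul, Matrix.det_mul, Matrix.det_transpose,
    show A.det * (Matrix.gram ℝ u).det * A.det = A.det ^ 2 * (Matrix.gram ℝ u).det by ring,
    Real.sqrt_mul (sq_nonneg _), Real.sqrt_sq_eq_abs]

/-- The Jacobian of `L` along `U`: the ratio of the `d`-volumes of `L u` and of `u`, for any frame
`u` of `U`. For an orthonormal frame the denominator is `1`. -/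
def jacobian {n d : ℕ} (L : E n →L[ℝ] E n) (U : OrientedGrassmannian n d) : ℝ :=
  Quotient.lift (s := frameSetoid n d)
    (fun u : Frame n d => frameVolume (fun i => L (u.1 i)) / frameVolume u.1)
    (by
      rintro u w ⟨A, hA, h⟩
      have h' : ∀ i, L (w.1 i) = ∑ j, A i j • L (u.1 j) := fun i => by simp [h i]
      have hd : |A.det| ≠ 0 := abs_ne_zero.mpr hA.ne'
      rw [frameVolume_comp h, frameVolume_comp h', mul_div_mul_left _ _ hd]) U

/-! ### Varifolds -/

/-- Oriented `d`-varifolds on `ℝⁿ`: finite Borel measures on `ℝⁿ × G̃`. (Such measures are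
automatically Radon, the space being locally compact and second countable.) -/
abbrev Varifold (n d : ℕ) := FiniteMeasure (E n × OrientedGrassmannian n d)

/-- The weight measure `|μ|` on `ℝⁿ`. -/
def weight {n d : ℕ} (μ : Measure (E n × OrientedGrassmannian n d)) : Measure (E n) :=
  μ.map Prod.fst

/-- The varifold pushforward of `μ` by `φ`: the measure `ν` with
`∫ ω dν = ∫ ω(φ x, d_xφ · U) J_U φ(x) dμ(x, U)`. -/
def pushforward {n d : ℕ} (φ : E n → E n) (μ : Measure (E n × OrientedGrassmannian n d)) :
    Measure (E n × OrientedGrassmannian n d) :=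
  (μ.withDensity fun p => ENNReal.ofReal (jacobian (fderiv ℝ φ p.1) p.2)).map
    fun p => (φ p.1, transport (fderiv ℝ φ p.1) p.2)

/-- The rescaled measure `α μ`, for a weight change `α` on `ℝⁿ`. -/
def rescale {n d : ℕ} (α : E n → ℝ) (μ : Measure (E n × OrientedGrassmannian n d)) :
    Measure (E n × OrientedGrassmannian n d) :=
  μ.withDensity fun p => ENNReal.ofReal (α p.1)

/-! ### Controls and admissible paths -/

/-- A realisation of the Hilbert space `V` as a space of vector fields on `ℝⁿ`, continuously
embedded in `C²₀(ℝⁿ, ℝⁿ)`. -/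
structure FieldSpace (n : ℕ) (V : Type*) [NormedAddCommGroup V] [InnerProductSpace ℝ V] where
  /-- the vector field given by an element of `V` -/
  field : V →ₗ[ℝ] (E n → E n)
  injective : Function.Injective field
  contDiff : ∀ u, ContDiff ℝ 2 (field u)
  vanish : ∀ u, ∀ k ≤ 2,
    Tendsto (fun x => ‖iteratedFDeriv ℝ k (field u) x‖) (cocompact (E n)) (𝓝 0)
  bound : ∃ c > 0, ∀ u, ∀ k ≤ 2, ∀ x, ‖iteratedFDeriv ℝ k (field u) x‖ ≤ c * ‖u‖

/-- Lebesgue measure on `[0,1]`. -/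
def unitTime : Measure ℝ := volume.restrict (Icc 0 1)

/-- `φ` is the flow on `[0,1]` of the time-dependent vector field `v`:
`φ_t(x) = x + ∫₀ᵗ v_s(φ_s(x)) ds`. -/
def IsFlow {n : ℕ} {V : Type*} [NormedAddCommGroup V] [InnerProductSpace ℝ V]
    (F : FieldSpace n V) (v : ℝ → V) (φ : ℝ → E n → E n) : Prop :=
  ∀ x, ContinuousOn (fun t => φ t x) (Icc 0 1) ∧
    ∀ t ∈ Icc (0 : ℝ) 1, φ t x = x + ∫ s in (0 : ℝ)..t, F.field (v s) (φ s x)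

/-- The square root of the weight change, `α̃_t(x) = 1 + ½ ∫₀ᵗ η_s(x) ds`. -/
def sqrtWeight {n : ℕ} (η : ℝ → E n → ℝ) (t : ℝ) (x : E n) : ℝ :=
  1 + (1 / 2) * ∫ s in (0 : ℝ)..t, η s x

/-- `(v, η) ∈ L²([0,1], V × L²(|μ|))`, `φ` is the flow of `v`, and the weight change stays strictly
positive. Here `L²([0,1], L²(|μ|))` is `L²(dt ⊗ |μ|)`. -/
structure Admissible {n d : ℕ} {V : Type*} [NormedAddCommGroup V] [InnerProductSpace ℝ V]
    (F : FieldSpace n V) (μ : Varifold n d) (v : ℝ → V) (φ : ℝ → E n → E n)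
    (η : ℝ → E n → ℝ) : Prop where
  memLp_field : MemLp v 2 unitTime
  isFlow : IsFlow F v φ
  memLp_weight : MemLp (Function.uncurry η) 2 (unitTime.prod (weight μ.toMeasure))
  pos : ∀ᵐ x ∂(weight μ.toMeasure), ∀ t ∈ Icc (0 : ℝ) 1, 0 < sqrtWeight η t x

/-- The transformed varifold `μ_t = ((α̃_t)² ∘ φ_t⁻¹) (φ_t)_# μ`. -/
def transformed {n d : ℕ} (μ : Varifold n d) (φ : ℝ → E n → E n) (η : ℝ → E n → ℝ) (t : ℝ) :
    Measure (E n × OrientedGrassmannian n d) :=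
  rescale (fun x => (sqrtWeight η t (Function.invFun (φ t) x)) ^ 2)
    (pushforward (φ t) μ.toMeasure)

/-- The orbit `Θ(μ)`. -/
def orbit {n d : ℕ} {V : Type*} [NormedAddCommGroup V] [InnerProductSpace ℝ V]
    (F : FieldSpace n V) (μ : Varifold n d) : Set (Varifold n d) :=
  {ν | ∃ v φ η, Admissible F μ v φ η ∧ ν.toMeasure = transformed μ φ η 1}

/-- The LDDMM-Fisher-Rao energy
`½ ∫₀¹ ‖v_t‖² dt + γ/2 ∫₀¹ ∫ (η_t)² ∘ φ_t⁻¹ d|(φ_t)_# μ| dt`. -/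
def energy {n d : ℕ} {V : Type*} [NormedAddCommGroup V] (γ : ℝ) (μ : Varifold n d) (v : ℝ → V)
    (φ : ℝ → E n → E n) (η : ℝ → E n → ℝ) : ℝ≥0∞ :=
  ENNReal.ofReal (1 / 2) * (∫⁻ t, ENNReal.ofReal (‖v t‖ ^ 2) ∂unitTime) +
    ENNReal.ofReal (γ / 2) *
      ∫⁻ t, ∫⁻ x, ENNReal.ofReal ((η t (Function.invFun (φ t) x)) ^ 2)
        ∂(weight (pushforward (φ t) μ.toMeasure)) ∂unitTime

/-- The LDDMM-Fisher-Rao distance: the square root of the infimum of the energy over the admissible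
paths from `μ` to `ν` (`∞` if there is none). -/
def distFR {n d : ℕ} {V : Type*} [NormedAddCommGroup V] [InnerProductSpace ℝ V]
    (F : FieldSpace n V) (γ : ℝ) (μ ν : Varifold n d) : ℝ≥0∞ :=
  (sInf {c : ℝ≥0∞ | ∃ v φ η, Admissible F μ v φ η ∧ ν.toMeasure = transformed μ φ η 1 ∧
    c = energy γ μ v φ η}) ^ (1 / 2 : ℝ)

end LddmmFR

end

/-!
The derivative of a vector field of `V` is Lipschitz with constant a multiple of `‖v‖`, so
Grönwall's inequality controls the second differences of the flow, whence each `φ_t` is `C¹`; it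
also bounds `d_xφ_t` and its inverse in terms of `∫₀¹ ‖v_t‖ dt`. The Jacobians along oriented planes
are then bounded above and below, and `L²` with respect to `|(φ_t)_# μ|` is the same space as
`L²(|μ|)`.

Admissible paths can be reversed at equal energy and run one after the other. Giving two paths the
fractions `l` and `1 - l` of the time interval yields the energy `c / l + c' / (1 - l)`, which is
`(√c + √c')²` for the best `l`; this is the triangle inequality.

If the distance from `μ` to `ν` vanishes, there are paths from `μ` to `ν` whose energy tends to `0`.
Their endpoint maps, their differentials and, along a subsequence, their weights tend to those of
the constant path, so by Fatou's lemma `μ(O) ≤ ν(O)` for each open set `O`; by symmetry `μ = ν`.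
-/

open MeasureTheory Set Filter Topology
open scoped ENNReal

noncomputable section

namespace LddmmFR

/-! ### Grönwall's inequality -/

theorem absolutelyContinuousOnInterval_comp_of_lipschitzOnWith {X Y : Type*}
    [PseudoMetricSpace X] [PseudoMetricSpace Y] {f : ℝ → X} {g : X → Y} {a b : ℝ} {K : NNReal}
    {s : Set X} (hg : LipschitzOnWith K g s) (hf : AbsolutelyContinuousOnInterval f a b)
    (hs : MapsTo f (uIcc a b) s) : AbsolutelyContinuousOnInterval (fun x => g (f x)) a b := by
  rw [absolutelyContinuousOnInterval_iff] at hf ⊢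
  intro ε hε
  obtain ⟨δ, hδ, H⟩ := hf (ε / (K + 1)) (by positivity)
  refine ⟨δ, hδ, fun I hI hIδ => ?_⟩
  have hsum := H I hI hIδ
  simp only [AbsolutelyContinuousOnInterval.disjWithin, mem_ofPred_eq, Finset.mem_range] at hI
  calc ∑ i ∈ Finset.range I.1, dist (g (f (I.2 i).1)) (g (f (I.2 i).2))
      ≤ ∑ i ∈ Finset.range I.1, (K + 1) * dist (f (I.2 i).1) (f (I.2 i).2) := by
        refine Finset.sum_le_sum fun i hi => ?_
        have hi := hI.1 i (Finset.mem_range.1 hi)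
        refine (hg.dist_le_mul _ (hs hi.1) _ (hs hi.2)).trans ?_
        gcongr
        exact le_add_of_nonneg_right zero_le_one
    _ = (K + 1) * ∑ i ∈ Finset.range I.1, dist (f (I.2 i).1) (f (I.2 i).2) := by
        rw [Finset.mul_sum]
    _ < (K + 1) * (ε / (K + 1)) := by gcongr
    _ = ε := by field_simp

theorem lipschitzOnWith_exp_Iic (M : ℝ) :
    LipschitzOnWith (Real.exp M).toNNReal Real.exp (Iic M) := by
  refine (convex_Iic M).lipschitzOnWith_of_nnnorm_deriv_le
    (fun x _ => Real.differentiableAt_exp) fun x hx => ?_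
  rw [Real.deriv_exp, ← NNReal.coe_le_coe, coe_nnnorm, Real.norm_of_nonneg (Real.exp_nonneg x),
    Real.coe_toNNReal _ (Real.exp_nonneg M)]
  exact Real.exp_le_exp.2 hx

theorem absolutelyContinuousOnInterval_exp {f : ℝ → ℝ} {a b : ℝ}
    (hf : AbsolutelyContinuousOnInterval f a b) :
    AbsolutelyContinuousOnInterval (fun t => Real.exp (f t)) a b := by
  obtain ⟨M, hM⟩ := hf.exists_bound
  exact absolutelyContinuousOnInterval_comp_of_lipschitzOnWith (lipschitzOnWith_exp_Iic M) hf
    fun t ht => (le_abs_self _).trans (hM t ht)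

theorem le_of_absolutelyContinuousOnInterval_of_deriv_nonpos {f : ℝ → ℝ} {a b : ℝ} (hab : a ≤ b)
    (hf : AbsolutelyContinuousOnInterval f a b) (hf' : ∀ᵐ t, t ∈ Icc a b → deriv f t ≤ 0) :
    f b ≤ f a := by
  rw [← sub_nonpos, ← hf.integral_deriv_eq_sub, ← neg_nonneg, ← intervalIntegral.integral_neg]
  refine intervalIntegral.integral_nonneg_of_ae_restrict hab ?_
  filter_upwards [ae_restrict_of_ae hf', ae_restrict_mem measurableSet_Icc] with t ht hmem
  exact neg_nonneg.2 (ht hmem)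

theorem le_mul_exp_integral_of_le_add_integral {u g : ℝ → ℝ} {C a b : ℝ} (hab : a ≤ b)
    (hg : IntervalIntegrable g volume a b)
    (hgu : IntervalIntegrable (fun s => g s * u s) volume a b) (hg0 : ∀ s ∈ Icc a b, 0 ≤ g s)
    (h : ∀ t ∈ Icc a b, u t ≤ C + ∫ s in a..t, g s * u s) :
    u b ≤ C * Real.exp (∫ s in a..b, g s) := by
  set G : ℝ → ℝ := fun t => ∫ s in a..t, g s with hG
  set R : ℝ → ℝ := fun t => C + ∫ s in a..t, g s * u s with hR
  have hRAC : AbsolutelyContinuousOnInterval R a b :=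
    ((LipschitzWith.const C).lipschitzOnWith.absolutelyContinuousOnInterval (K := 0)).fun_add
      (hgu.absolutelyContinuousOnInterval_intervalIntegral left_mem_uIcc)
  have heAC : AbsolutelyContinuousOnInterval (fun t => Real.exp (-G t)) a b :=
    absolutelyContinuousOnInterval_exp
      (hg.absolutelyContinuousOnInterval_intervalIntegral left_mem_uIcc).fun_neg
  have hanti : R b * Real.exp (-G b) ≤ R a * Real.exp (-G a) := by
    refine le_of_absolutelyContinuousOnInterval_of_deriv_nonpos hab (hRAC.fun_mul heAC) ?_
    filter_upwards [hg.ae_hasDerivAt_integral, hgu.ae_hasDerivAt_integral] with t hGt hRt ht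
    have ht' : t ∈ uIcc a b := by rwa [uIcc_of_le hab]
    have hG' : HasDerivAt G (g t) t := hGt ht' a left_mem_uIcc
    have hR' : HasDerivAt R (g t * u t) t := (hRt ht' a left_mem_uIcc).const_add C
    rw [(hR'.fun_mul hG'.fun_neg.exp).deriv]
    have : 0 ≤ g t * Real.exp (-G t) * (R t - u t) :=
      mul_nonneg (mul_nonneg (hg0 t ht) (Real.exp_nonneg _)) (sub_nonneg.2 (h t ht))
    linarith
  have hRa : R a * Real.exp (-G a) = C := by simp [hR, hG]
  calc u b ≤ R b := h b (right_mem_Icc.2 hab)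
    _ = R b * Real.exp (-G b) * Real.exp (G b) := by rw [mul_assoc, ← Real.exp_add]; simp
    _ ≤ C * Real.exp (G b) := by rw [← hRa]; gcongr

/-! ### Primitives of integrable functions -/

/-- `w` is a primitive on `[a, b]` of the integrable function `f`: the integral form of `w' = f`,
which is how flows and square-root weights are given. -/
structure IsPrimitiveOn {Y : Type*} [NormedAddCommGroup Y] [NormedSpace ℝ Y] (w f : ℝ → Y)
    (a b : ℝ) : Prop where
  le : a ≤ b
  intervalIntegrable : IntervalIntegrable f volume a b
  apply_eq : ∀ t ∈ Icc a b, w t = w a + ∫ s in a..t, f s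

namespace IsPrimitiveOn

variable {Y : Type*} [NormedAddCommGroup Y] [NormedSpace ℝ Y] {w w' f f' : ℝ → Y} {a b c : ℝ}

theorem left_mem (h : IsPrimitiveOn w f a b) : a ∈ Icc a b := left_mem_Icc.2 h.le

theorem right_mem (h : IsPrimitiveOn w f a b) : b ∈ Icc a b := right_mem_Icc.2 h.le

theorem intervalIntegrable_of_mem (h : IsPrimitiveOn w f a b) {s t : ℝ} (hs : s ∈ Icc a b)
    (ht : t ∈ Icc a b) : IntervalIntegrable f volume s t :=
  h.intervalIntegrable.mono_set (uIcc_subset_uIcc (Icc_subset_uIcc hs) (Icc_subset_uIcc ht))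

theorem integral_eq_sub (h : IsPrimitiveOn w f a b) {s t : ℝ} (hs : s ∈ Icc a b)
    (ht : t ∈ Icc a b) : ∫ r in s..t, f r = w t - w s := by
  rw [h.apply_eq s hs, h.apply_eq t ht, add_sub_add_left_eq_sub,
    intervalIntegral.integral_interval_sub_left (h.intervalIntegrable_of_mem h.left_mem ht)
      (h.intervalIntegrable_of_mem h.left_mem hs)]

theorem mono (h : IsPrimitiveOn w f a b) {s t : ℝ} (hs : s ∈ Icc a b) (ht : t ∈ Icc a b)
    (hst : s ≤ t) : IsPrimitiveOn w f s t where
  le := hst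
  intervalIntegrable := h.intervalIntegrable_of_mem hs ht
  apply_eq r hr := by
    rw [h.integral_eq_sub hs ⟨hs.1.trans hr.1, hr.2.trans ht.2⟩, add_sub_cancel]

theorem continuousOn (h : IsPrimitiveOn w f a b) : ContinuousOn w (Icc a b) := by
  have := intervalIntegral.continuousOn_primitive_interval
    ((intervalIntegrable_iff' (μ := volume)).1 h.intervalIntegrable)
  rw [uIcc_of_le h.le] at this
  exact (continuousOn_const.add this).congr h.apply_eq

theorem sub (h : IsPrimitiveOn w f a b) (h' : IsPrimitiveOn w' f' a b) :
    IsPrimitiveOn (fun t => w t - w' t) (fun t => f t - f' t) a b where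
  le := h.le
  intervalIntegrable := h.intervalIntegrable.sub h'.intervalIntegrable
  apply_eq t ht := by
    rw [intervalIntegral.integral_sub (h.intervalIntegrable_of_mem h.left_mem ht)
      (h'.intervalIntegrable_of_mem h.left_mem ht), h.integral_eq_sub h.left_mem ht,
      h'.integral_eq_sub h.left_mem ht]
    abel

theorem sub_const (h : IsPrimitiveOn w f a b) (y : Y) : IsPrimitiveOn (fun t => w t - y) f a b where
  le := h.le
  intervalIntegrable := h.intervalIntegrable
  apply_eq t ht := by rw [h.apply_eq t ht]; abel

theorem const_smul (h : IsPrimitiveOn w f a b) (r : ℝ) :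
    IsPrimitiveOn (fun t => r • w t) (fun t => r • f t) a b where
  le := h.le
  intervalIntegrable := h.intervalIntegrable.smul r
  apply_eq t ht := by rw [intervalIntegral.integral_smul, ← smul_add, ← h.apply_eq t ht]

theorem congr (h : IsPrimitiveOn w f a b) (hw : EqOn w w' (Icc a b)) (hf : EqOn f f' (Ioc a b)) :
    IsPrimitiveOn w' f' a b where
  le := h.le
  intervalIntegrable := h.intervalIntegrable.congr (by rwa [uIoc_of_le h.le])
  apply_eq t ht := by
    rw [← hw ht, ← hw h.left_mem, h.apply_eq t ht, intervalIntegral.integral_congr_ae]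
    refine Eventually.of_forall fun s hs => ?_
    rw [uIoc_of_le ht.1] at hs
    exact hf ⟨hs.1, hs.2.trans ht.2⟩

theorem trans (h : IsPrimitiveOn w f a b) (h' : IsPrimitiveOn w f b c) :
    IsPrimitiveOn w f a c where
  le := h.le.trans h'.le
  intervalIntegrable := h.intervalIntegrable.trans h'.intervalIntegrable
  apply_eq t ht := by
    rcases le_total t b with htb | hbt
    · exact h.apply_eq t ⟨ht.1, htb⟩
    · have ht' : t ∈ Icc b c := ⟨hbt, ht.2⟩
      rw [← intervalIntegral.integral_add_adjacent_intervals h.intervalIntegrable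
        (h'.intervalIntegrable_of_mem h'.left_mem ht'), h'.integral_eq_sub h'.left_mem ht',
        h.integral_eq_sub h.left_mem h.right_mem]
      abel

theorem comp_sub_left (h : IsPrimitiveOn w f a b) (c : ℝ) :
    IsPrimitiveOn (fun t => w (c - t)) (fun t => -f (c - t)) (c - b) (c - a) where
  le := sub_le_sub_left h.le c
  intervalIntegrable := (h.intervalIntegrable.comp_sub_left c).symm.neg
  apply_eq t ht := by
    rw [intervalIntegral.integral_neg, intervalIntegral.integral_comp_sub_left, sub_sub_cancel,
      h.integral_eq_sub ⟨by linarith [ht.2], by linarith [ht.1]⟩ h.right_mem]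
    abel

theorem comp_sub_div (h : IsPrimitiveOn w f a b) {l : ℝ} (hl : 0 < l) (m : ℝ) :
    IsPrimitiveOn (fun t => w ((t - m) / l)) (fun t => l⁻¹ • f ((t - m) / l))
      (l * a + m) (l * b + m) where
  le := by have := h.le; gcongr
  intervalIntegrable := by
    have := ((h.intervalIntegrable.comp_mul_left (c := l⁻¹)).comp_sub_right m).smul l⁻¹
    simpa only [div_inv_eq_mul, mul_comm _ l, inv_mul_eq_div, Pi.smul_def] using this
  apply_eq t ht := by
    have hm : ∀ s, (s - m) / l = s / l - m / l := fun s => sub_div s m l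
    have ht' : (t - m) / l ∈ Icc a b := by
      rw [mem_Icc, le_div_iff₀ hl, div_le_iff₀ hl]
      constructor <;> linarith [ht.1, ht.2]
    simp only [hm]
    rw [intervalIntegral.integral_smul, intervalIntegral.inv_smul_integral_comp_div_sub,
      ← hm, ← hm, add_sub_cancel_right, mul_div_cancel_left₀ _ hl.ne',
      h.integral_eq_sub h.left_mem ht', add_sub_cancel]

theorem norm_sub_le (h : IsPrimitiveOn w f a b) {g : ℝ → ℝ} (hg : IntervalIntegrable g volume a b)
    (hf : ∀ s, ‖f s‖ ≤ g s) : ‖w b - w a‖ ≤ ∫ s in a..b, g s := by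
  rw [← h.integral_eq_sub h.left_mem h.right_mem]
  exact intervalIntegral.norm_integral_le_of_norm_le h.le (Eventually.of_forall fun s _ => hf s) hg

/-- With `B = 0` this bounds the divergence of two solutions of an ODE; `B > 0` allows for a forcing
term. -/
theorem norm_add_le_mul_exp (h : IsPrimitiveOn w f a b) {g : ℝ → ℝ} {B : ℝ}
    (hg : IntervalIntegrable g volume a b) (hg0 : ∀ s ∈ Icc a b, 0 ≤ g s)
    (hf : ∀ s ∈ Icc a b, ‖f s‖ ≤ g s * (‖w s‖ + B)) :
    ‖w b‖ + B ≤ (‖w a‖ + B) * Real.exp (∫ s in a..b, g s) := by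
  have hgw : IntervalIntegrable (fun s => g s * (‖w s‖ + B)) volume a b :=
    hg.mul_continuousOn (by rw [uIcc_of_le h.le]; exact h.continuousOn.norm.add_const B)
  refine le_mul_exp_integral_of_le_add_integral h.le hg hgw hg0 fun t ht => ?_
  have hint : ‖∫ s in a..t, f s‖ ≤ ∫ s in a..t, g s * (‖w s‖ + B) := by
    refine intervalIntegral.norm_integral_le_of_norm_le ht.1 (Eventually.of_forall fun s hs => ?_)
      (hgw.mono_set (uIcc_subset_uIcc_left (Icc_subset_uIcc ht)))
    exact hf s ⟨hs.1.le, hs.2.trans ht.2⟩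
  have := norm_add_le (w a) (∫ s in a..t, f s)
  rw [← h.apply_eq t ht] at this
  linarith

theorem norm_add_le_mul_exp_of_right (h : IsPrimitiveOn w f a b) {g : ℝ → ℝ} {B : ℝ}
    (hg : IntervalIntegrable g volume a b) (hg0 : ∀ s ∈ Icc a b, 0 ≤ g s)
    (hf : ∀ s ∈ Icc a b, ‖f s‖ ≤ g s * (‖w s‖ + B)) :
    ‖w a‖ + B ≤ (‖w b‖ + B) * Real.exp (∫ s in a..b, g s) := by
  have hrev := h.comp_sub_left (a + b)
  have hmem : ∀ s ∈ Icc a b, a + b - s ∈ Icc a b := fun s hs =>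
    ⟨by linarith [hs.2], by linarith [hs.1]⟩
  rw [add_sub_cancel_right, add_sub_cancel_left] at hrev
  have hgrev := (hg.comp_sub_left (a + b)).symm
  rw [add_sub_cancel_right, add_sub_cancel_left] at hgrev
  have := hrev.norm_add_le_mul_exp hgrev (fun s hs => hg0 _ (hmem s hs)) (B := B)
    fun s hs => by rw [norm_neg]; exact hf _ (hmem s hs)
  simpa only [intervalIntegral.integral_comp_sub_left, add_sub_cancel_right,
    add_sub_cancel_left] using this

end IsPrimitiveOn

/-! ### Maps with bounded second differences -/

section SecondDifference

variable {X Y : Type*} [NormedAddCommGroup X] [NormedSpace ℝ X] [NormedAddCommGroup Y]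
  [NormedSpace ℝ Y] {f : X → Y} {C L : ℝ}

/-- The difference quotient of `f` at `x` in the direction `e` with step `2⁻ᵏ`. Dyadic steps make
consecutive quotients differ by a second difference. -/
def dyadicQuotient (f : X → Y) (x e : X) (k : ℕ) : Y :=
  (2 : ℝ) ^ k • (f (x + ((2 : ℝ) ^ k)⁻¹ • e) - f x)

/-- The directional derivative of `f`, as the limit of the dyadic difference quotients. -/
def dyadicDeriv (f : X → Y) (x e : X) : Y := limUnder atTop (dyadicQuotient f x e)

theorem norm_two_pow_smul (k : ℕ) (y : Y) : ‖(2 : ℝ) ^ k • y‖ = 2 ^ k * ‖y‖ := by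
  rw [norm_smul, norm_pow, Real.norm_ofNat]

theorem norm_two_pow_inv_smul (k : ℕ) (y : Y) : ‖((2 : ℝ) ^ k)⁻¹ • y‖ = ‖y‖ / 2 ^ k := by
  rw [norm_smul, norm_inv, norm_pow, Real.norm_ofNat, inv_mul_eq_div]

theorem norm_dyadicQuotient_le (hL : ∀ x y, ‖f x - f y‖ ≤ L * ‖x - y‖) (x e : X) (k : ℕ) :
    ‖dyadicQuotient f x e k‖ ≤ L * ‖e‖ := by
  calc ‖dyadicQuotient f x e k‖
      ≤ 2 ^ k * (L * ‖x + ((2 : ℝ) ^ k)⁻¹ • e - x‖) := by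
        rw [dyadicQuotient, norm_two_pow_smul]
        gcongr
        exact hL _ _
    _ = L * ‖e‖ := by rw [add_sub_cancel_left, norm_two_pow_inv_smul]; field_simp

theorem norm_dyadicQuotient_sub_le
    (hC : ∀ x p q, ‖f (x + p + q) - f (x + p) - f (x + q) + f x‖ ≤ C * ‖p‖ * ‖q‖)
    (x p e : X) (k : ℕ) :
    ‖dyadicQuotient f (x + p) e k - dyadicQuotient f x e k‖ ≤ C * ‖p‖ * ‖e‖ := by
  have hsub : dyadicQuotient f (x + p) e k - dyadicQuotient f x e k =
      (2 : ℝ) ^ k • (f (x + p + ((2 : ℝ) ^ k)⁻¹ • e) - f (x + p) -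
        f (x + ((2 : ℝ) ^ k)⁻¹ • e) + f x) := by
    rw [dyadicQuotient, dyadicQuotient]
    module
  rw [hsub, norm_two_pow_smul]
  calc 2 ^ k * ‖f (x + p + ((2 : ℝ) ^ k)⁻¹ • e) - f (x + p) - f (x + ((2 : ℝ) ^ k)⁻¹ • e) + f x‖
      ≤ 2 ^ k * (C * ‖p‖ * ‖((2 : ℝ) ^ k)⁻¹ • e‖) := by gcongr; exact hC _ _ _
    _ = C * ‖p‖ * ‖e‖ := by rw [norm_two_pow_inv_smul]; field_simp

theorem dyadicQuotient_add (f : X → Y) (x e e' : X) (k : ℕ) :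
    dyadicQuotient f x (e + e') k =
      dyadicQuotient f x e k + dyadicQuotient f (x + ((2 : ℝ) ^ k)⁻¹ • e) e' k := by
  rw [dyadicQuotient, dyadicQuotient, dyadicQuotient, smul_add, ← add_assoc]
  module

theorem two_smul_dyadicQuotient_sub_succ (f : X → Y) (x e : X) (k : ℕ) :
    (2 : ℝ) • (dyadicQuotient f x e k - dyadicQuotient f x e (k + 1)) =
      dyadicQuotient f (x + ((2 : ℝ) ^ (k + 1))⁻¹ • e) e (k + 1) -
        dyadicQuotient f x e (k + 1) := by
  have hstep : ((2 : ℝ) ^ k)⁻¹ • e = ((2 : ℝ) ^ (k + 1))⁻¹ • e + ((2 : ℝ) ^ (k + 1))⁻¹ • e := by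
    rw [← add_smul, pow_succ]
    congr 1
    field_simp
    norm_num
  rw [dyadicQuotient, dyadicQuotient, dyadicQuotient, hstep, ← add_assoc, pow_succ]
  module

theorem dist_dyadicQuotient_succ_le
    (hC : ∀ x p q, ‖f (x + p + q) - f (x + p) - f (x + q) + f x‖ ≤ C * ‖p‖ * ‖q‖)
    (x e : X) (k : ℕ) :
    dist (dyadicQuotient f x e k) (dyadicQuotient f x e (k + 1)) ≤
      (C * ‖e‖ ^ 2 / 2) / 2 / 2 ^ k := by
  have h := norm_dyadicQuotient_sub_le hC x (((2 : ℝ) ^ (k + 1))⁻¹ • e) e (k + 1)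
  rw [← two_smul_dyadicQuotient_sub_succ, norm_smul, Real.norm_ofNat, norm_two_pow_inv_smul,
    ← dist_eq_norm, pow_succ] at h
  calc dist (dyadicQuotient f x e k) (dyadicQuotient f x e (k + 1))
      ≤ C * (‖e‖ / (2 ^ k * 2)) * ‖e‖ / 2 := by linarith
    _ = (C * ‖e‖ ^ 2 / 2) / 2 / 2 ^ k := by field_simp

theorem tendsto_dyadicQuotient [CompleteSpace Y]
    (hC : ∀ x p q, ‖f (x + p + q) - f (x + p) - f (x + q) + f x‖ ≤ C * ‖p‖ * ‖q‖) (x e : X) :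
    Tendsto (dyadicQuotient f x e) atTop (𝓝 (dyadicDeriv f x e)) :=
  tendsto_nhds_limUnder <| cauchySeq_tendsto_of_complete <|
    cauchySeq_of_le_geometric_two (dist_dyadicQuotient_succ_le hC x e)

variable [CompleteSpace Y]

theorem dyadicDeriv_add
    (hC : ∀ x p q, ‖f (x + p + q) - f (x + p) - f (x + q) + f x‖ ≤ C * ‖p‖ * ‖q‖) (x e e' : X) :
    dyadicDeriv f x (e + e') = dyadicDeriv f x e + dyadicDeriv f x e' := by
  have herr : Tendsto (fun k => dyadicQuotient f (x + ((2 : ℝ) ^ k)⁻¹ • e) e' k -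
      dyadicQuotient f x e' k) atTop (𝓝 0) := by
    refine squeeze_zero_norm (fun k => norm_dyadicQuotient_sub_le hC x _ e' k) ?_
    have : Tendsto (fun k : ℕ => ‖e‖ / (2 : ℝ) ^ k) atTop (𝓝 0) :=
      tendsto_const_nhds.div_atTop (tendsto_pow_atTop_atTop_of_one_lt one_lt_two)
    simpa only [norm_two_pow_inv_smul, mul_zero, zero_mul] using
      (this.const_mul C).mul_const ‖e'‖
  have hlim := ((tendsto_dyadicQuotient hC x e).add (tendsto_dyadicQuotient hC x e')).add herr
  rw [add_zero] at hlim
  refine tendsto_nhds_unique (tendsto_dyadicQuotient hC x (e + e')) (hlim.congr fun k => ?_)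
  rw [dyadicQuotient_add, add_assoc, add_sub_cancel]

theorem norm_dyadicDeriv_le (hL : ∀ x y, ‖f x - f y‖ ≤ L * ‖x - y‖)
    (hC : ∀ x p q, ‖f (x + p + q) - f (x + p) - f (x + q) + f x‖ ≤ C * ‖p‖ * ‖q‖) (x e : X) :
    ‖dyadicDeriv f x e‖ ≤ L * ‖e‖ :=
  le_of_tendsto (tendsto_dyadicQuotient hC x e).norm <|
    Eventually.of_forall fun k => norm_dyadicQuotient_le hL x e k

theorem norm_dyadicDeriv_sub_le
    (hC : ∀ x p q, ‖f (x + p + q) - f (x + p) - f (x + q) + f x‖ ≤ C * ‖p‖ * ‖q‖) (x y e : X) :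
    ‖dyadicDeriv f y e - dyadicDeriv f x e‖ ≤ C * ‖y - x‖ * ‖e‖ := by
  refine le_of_tendsto ((tendsto_dyadicQuotient hC y e).sub (tendsto_dyadicQuotient hC x e)).norm
    (Eventually.of_forall fun k => ?_)
  simpa only [add_sub_cancel] using norm_dyadicQuotient_sub_le hC x (y - x) e k

theorem norm_sub_sub_dyadicDeriv_le
    (hC : ∀ x p q, ‖f (x + p + q) - f (x + p) - f (x + q) + f x‖ ≤ C * ‖p‖ * ‖q‖) (x e : X) :
    ‖f (x + e) - f x - dyadicDeriv f x e‖ ≤ C * ‖e‖ ^ 2 / 2 := by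
  have := dist_le_of_le_geometric_two_of_tendsto₀ (dist_dyadicQuotient_succ_le hC x e)
    (tendsto_dyadicQuotient hC x e)
  simpa [dyadicQuotient, dist_eq_norm] using this

theorem exists_hasFDerivAt_of_secondDiff_le (hL : ∀ x y, ‖f x - f y‖ ≤ L * ‖x - y‖)
    (hC : ∀ x p q, ‖f (x + p + q) - f (x + p) - f (x + q) + f x‖ ≤ C * ‖p‖ * ‖q‖) (x : X) :
    ∃ D : X →L[ℝ] Y, HasFDerivAt f D x ∧ ∀ e, D e = dyadicDeriv f x e := by
  let A : X →+ Y := AddMonoidHom.mk' (dyadicDeriv f x) (dyadicDeriv_add hC x)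
  let D : X →L[ℝ] Y := A.toRealLinearMap
    (AddMonoidHomClass.continuous_of_bound A L (norm_dyadicDeriv_le hL hC x))
  refine ⟨D, ?_, fun _ => rfl⟩
  rw [hasFDerivAt_iff_isLittleO_nhds_zero]
  refine Asymptotics.IsBigO.trans_isLittleO (g := fun h : X => ‖h‖ ^ 2)
    (Asymptotics.IsBigO.of_bound (C / 2) (Eventually.of_forall fun h => ?_))
    (Asymptotics.isLittleO_norm_pow_id one_lt_two)
  rw [Real.norm_of_nonneg (by positivity), div_mul_eq_mul_div]
  exact norm_sub_sub_dyadicDeriv_le hC x h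

theorem contDiff_one_of_secondDiff_le (hL : ∀ x y, ‖f x - f y‖ ≤ L * ‖x - y‖)
    (hC : ∀ x p q, ‖f (x + p + q) - f (x + p) - f (x + q) + f x‖ ≤ C * ‖p‖ * ‖q‖) :
    ContDiff ℝ 1 f := by
  choose D hD hDeriv using exists_hasFDerivAt_of_secondDiff_le hL hC
  have hlip : ∀ x y, ‖D y - D x‖ ≤ |C| * ‖y - x‖ := fun x y =>
    ContinuousLinearMap.opNorm_le_bound _ (by positivity) fun e => by
      rw [sub_apply, hDeriv, hDeriv]
      refine (norm_dyadicDeriv_sub_le hC x y e).trans ?_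
      gcongr
      exact le_abs_self C
  have hcont : Continuous D :=
    (LipschitzWith.of_dist_le' fun y x => by simpa only [dist_eq_norm] using hlip x y).continuous
  rw [contDiff_one_iff_fderiv, funext fun x => (hD x).fderiv]
  exact ⟨fun x => (hD x).differentiableAt, hcont⟩

end SecondDifference

theorem norm_fderiv_le_of_norm_sub_le {X Y : Type*} [NormedAddCommGroup X] [NormedSpace ℝ X]
    [NormedAddCommGroup Y] [NormedSpace ℝ Y] {f : X → Y} {L : ℝ} (hL0 : 0 ≤ L)
    (hL : ∀ x y, ‖f x - f y‖ ≤ L * ‖x - y‖) (x : X) : ‖fderiv ℝ f x‖ ≤ L := by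
  have hlip : LipschitzWith L.toNNReal f := LipschitzWith.of_dist_le' fun x y => by
    simpa only [dist_eq_norm] using hL x y
  simpa only [Real.coe_toNNReal _ hL0] using norm_fderiv_le_of_lipschitz ℝ hlip (x₀ := x)

theorem norm_le_mul_norm_fderiv_apply {X Y : Type*} [NormedAddCommGroup X] [NormedSpace ℝ X]
    [NormedAddCommGroup Y] [NormedSpace ℝ Y] {f : X → Y} {K : ℝ}
    (hK : ∀ x y, ‖x - y‖ ≤ K * ‖f x - f y‖) {x : X} (hf : DifferentiableAt ℝ f x) (e : X) :
    ‖e‖ ≤ K * ‖fderiv ℝ f x e‖ := by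
  refine ge_of_tendsto ((hf.hasFDerivAt.lim_real e).norm.const_mul K) ?_
  filter_upwards [eventually_gt_atTop 0] with c hc
  have hstep := hK (x + c⁻¹ • e) x
  rw [add_sub_cancel_left, norm_smul, norm_inv, Real.norm_of_nonneg hc.le] at hstep
  rw [norm_smul, Real.norm_of_nonneg hc.le]
  calc ‖e‖ = c * (c⁻¹ * ‖e‖) := by field_simp
    _ ≤ c * (K * ‖f (x + c⁻¹ • e) - f x‖) := by gcongr
    _ = K * (c * ‖f (x + c⁻¹ • e) - f x‖) := by ring

theorem injective_of_norm_le_mul_norm_apply {X Y : Type*} [NormedAddCommGroup X] [NormedSpace ℝ X]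
    [NormedAddCommGroup Y] [NormedSpace ℝ Y] {L : X →L[ℝ] Y} {K : ℝ}
    (hL : ∀ e, ‖e‖ ≤ K * ‖L e‖) : Function.Injective L := by
  refine (injective_iff_map_eq_zero L).2 fun e he => norm_le_zero_iff.1 ?_
  simpa only [he, norm_zero, mul_zero] using hL e

/-! ### Flows -/

section Flow

variable {n : ℕ} {V : Type*} [NormedAddCommGroup V] [InnerProductSpace ℝ V]

/-- A bound for the norm of the embedding of `V` into `C²₀`. -/
def FieldSpace.embConst (F : FieldSpace n V) : ℝ := F.bound.choose

theorem FieldSpace.embConst_pos (F : FieldSpace n V) : 0 < F.embConst := F.bound.choose_spec.1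

theorem FieldSpace.norm_iteratedFDeriv_le (F : FieldSpace n V) (u : V) {k : ℕ} (hk : k ≤ 2)
    (x : E n) : ‖iteratedFDeriv ℝ k (F.field u) x‖ ≤ F.embConst * ‖u‖ :=
  F.bound.choose_spec.2 u k hk x

theorem FieldSpace.norm_field_le (F : FieldSpace n V) (u : V) (x : E n) :
    ‖F.field u x‖ ≤ F.embConst * ‖u‖ := by
  simpa using F.norm_iteratedFDeriv_le u (k := 0) (by norm_num) x

theorem FieldSpace.norm_field_sub_le (F : FieldSpace n V) (u : V) (x y : E n) :
    ‖F.field u x - F.field u y‖ ≤ F.embConst * ‖u‖ * ‖x - y‖ := by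
  refine convex_univ.norm_image_sub_le_of_norm_fderiv_le (𝕜 := ℝ)
    (fun z _ => ((F.contDiff u).differentiable (by norm_num)).differentiableAt) (fun z _ => ?_)
    (mem_univ y) (mem_univ x)
  simpa [norm_iteratedFDeriv_one] using F.norm_iteratedFDeriv_le u (k := 1) (by norm_num) z

theorem FieldSpace.norm_fderiv_sub_le (F : FieldSpace n V) (u : V) (x y : E n) :
    ‖fderiv ℝ (F.field u) x - fderiv ℝ (F.field u) y‖ ≤ F.embConst * ‖u‖ * ‖x - y‖ := by
  have hd : ContDiff ℝ 1 (fderiv ℝ (F.field u)) :=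
    (F.contDiff u).fderiv_right (by norm_num)
  refine convex_univ.norm_image_sub_le_of_norm_fderiv_le (𝕜 := ℝ)
    (fun z _ => (hd.differentiable (by norm_num)).differentiableAt) (fun z _ => ?_)
    (mem_univ y) (mem_univ x)
  rw [← norm_iteratedFDeriv_one, norm_iteratedFDeriv_fderiv]
  exact F.norm_iteratedFDeriv_le u (by norm_num) z

theorem FieldSpace.norm_field_secondDiff_le (F : FieldSpace n V) (u : V) (a p q : E n) :
    ‖F.field u (a + p + q) - F.field u (a + p) - F.field u (a + q) + F.field u a‖ ≤
      F.embConst * ‖u‖ * ‖p‖ * ‖q‖ := by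
  have hd : Differentiable ℝ (F.field u) := (F.contDiff u).differentiable (by norm_num)
  have hd' : ∀ z, HasFDerivAt (fun y => F.field u (y + q) - F.field u y)
      (fderiv ℝ (F.field u) (z + q) - fderiv ℝ (F.field u) z) z := fun z => by
    have h := (hd (z + q)).hasFDerivAt.comp z ((hasFDerivAt_id z).add_const q)
    rw [ContinuousLinearMap.comp_id] at h
    exact h.fun_sub (hd z).hasFDerivAt
  have := convex_univ.norm_image_sub_le_of_norm_fderiv_le (𝕜 := ℝ)
    (f := fun y => F.field u (y + q) - F.field u y) (C := F.embConst * ‖u‖ * ‖q‖)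
    (fun z _ => (hd' z).differentiableAt) (fun z _ => ?_) (mem_univ a) (mem_univ (a + p))
  · calc _ = ‖F.field u (a + p + q) - F.field u (a + p) - (F.field u (a + q) - F.field u a)‖ := by
          congr 1; abel
      _ ≤ _ := this
      _ = _ := by rw [add_sub_cancel_left]; ring
  · rw [(hd' z).fderiv]
    simpa using F.norm_fderiv_sub_le u (z + q) z

theorem FieldSpace.norm_field_alternating_sum_le (F : FieldSpace n V) (u : V) (a b c z : E n) :
    ‖F.field u z - F.field u b - (F.field u c - F.field u a)‖ ≤
      F.embConst * ‖u‖ * (‖z - b - (c - a)‖ + ‖b - a‖ * ‖c - a‖) := by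
  have hvertex := F.norm_field_sub_le u z (b + (c - a))
  have hpar := F.norm_field_secondDiff_le u a (b - a) (c - a)
  rw [← sub_sub] at hvertex
  rw [add_sub_cancel, add_sub_cancel] at hpar
  calc ‖F.field u z - F.field u b - (F.field u c - F.field u a)‖
      = ‖(F.field u z - F.field u (b + (c - a))) +
          (F.field u (b + (c - a)) - F.field u b - F.field u c + F.field u a)‖ := by
        congr 1; abel
    _ ≤ F.embConst * ‖u‖ * ‖z - b - (c - a)‖ + F.embConst * ‖u‖ * ‖b - a‖ * ‖c - a‖ :=
        (norm_add_le _ _).trans (add_le_add hvertex hpar)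
    _ = F.embConst * ‖u‖ * (‖z - b - (c - a)‖ + ‖b - a‖ * ‖c - a‖) := by ring

theorem FieldSpace.continuous_field (F : FieldSpace n V) :
    Continuous fun p : V × E n => F.field p.1 p.2 := by
  refine continuous_iff_continuousAt.2 fun p => ?_
  rw [ContinuousAt, tendsto_iff_norm_sub_tendsto_zero]
  have hbound : ∀ q : V × E n, ‖F.field q.1 q.2 - F.field p.1 p.2‖ ≤
      F.embConst * ‖q.1 - p.1‖ + F.embConst * ‖p.1‖ * ‖q.2 - p.2‖ := fun q => by
    have hfield := F.norm_field_le (q.1 - p.1) q.2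
    rw [map_sub, Pi.sub_apply] at hfield
    exact (norm_sub_le_norm_sub_add_norm_sub _ (F.field p.1 q.2) _).trans
      (add_le_add hfield (F.norm_field_sub_le p.1 q.2 p.2))
  refine squeeze_zero (fun _ => norm_nonneg _) hbound ?_
  have : Continuous fun q : V × E n =>
      F.embConst * ‖q.1 - p.1‖ + F.embConst * ‖p.1‖ * ‖q.2 - p.2‖ := by fun_prop
  simpa using this.tendsto p

instance : IsProbabilityMeasure unitTime := ⟨by simp [unitTime]⟩

theorem intervalIntegrable_iff_integrable_unitTime {Y : Type*} [NormedAddCommGroup Y] {f : ℝ → Y} :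
    IntervalIntegrable f volume 0 1 ↔ Integrable f unitTime :=
  intervalIntegrable_iff_integrableOn_Icc_of_le zero_le_one

theorem FieldSpace.integrable_field_comp (F : FieldSpace n V) {v : ℝ → V}
    (hv : Integrable v unitTime) {γ : ℝ → E n} (hγ : ContinuousOn γ (Icc 0 1)) :
    Integrable (fun s => F.field (v s) (γ s)) unitTime := by
  refine (hv.norm.const_mul F.embConst).mono' ?_ (Eventually.of_forall fun s => F.norm_field_le _ _)
  exact F.continuous_field.comp_aestronglyMeasurable
    (hv.1.prodMk (hγ.aestronglyMeasurable measurableSet_Icc))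

/-- The total strength `c ∫₀¹ ‖v_s‖ ds` of a time-dependent field, which controls its flow. -/
def flowConst (F : FieldSpace n V) (v : ℝ → V) : ℝ :=
  F.embConst * ∫ s in (0 : ℝ)..1, ‖v s‖

theorem embConst_mul_norm_nonneg (F : FieldSpace n V) (u : V) : 0 ≤ F.embConst * ‖u‖ :=
  mul_nonneg F.embConst_pos.le (norm_nonneg _)

theorem flowConst_nonneg (F : FieldSpace n V) (v : ℝ → V) : 0 ≤ flowConst F v :=
  mul_nonneg F.embConst_pos.le
    (intervalIntegral.integral_nonneg zero_le_one fun _ _ => norm_nonneg _)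

section

variable {F : FieldSpace n V} {v : ℝ → V} {t : ℝ}

theorem intervalIntegrable_embConst_mul_norm (hv : Integrable v unitTime)
    (ht : t ∈ Icc (0 : ℝ) 1) : IntervalIntegrable (fun s => F.embConst * ‖v s‖) volume 0 t :=
  (intervalIntegrable_iff_integrable_unitTime.2 (hv.norm.const_mul _)).mono_set
    (uIcc_subset_uIcc_left (Icc_subset_uIcc ht))

theorem integral_embConst_mul_norm_le (hv : Integrable v unitTime) (ht : t ∈ Icc (0 : ℝ) 1) :
    ∫ s in (0 : ℝ)..t, F.embConst * ‖v s‖ ≤ flowConst F v := by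
  rw [flowConst, ← intervalIntegral.integral_const_mul]
  exact intervalIntegral.integral_mono_interval le_rfl ht.1 ht.2
    (Eventually.of_forall fun s => embConst_mul_norm_nonneg F (v s))
    (intervalIntegrable_embConst_mul_norm hv (right_mem_Icc.2 zero_le_one))

variable {Y : Type*} [NormedAddCommGroup Y] [NormedSpace ℝ Y] {w f : ℝ → Y} {B : ℝ}

theorem IsPrimitiveOn.norm_add_le_exp_flowConst (h : IsPrimitiveOn w f 0 1)
    (hv : Integrable v unitTime) (hB : 0 ≤ B)
    (hf : ∀ s ∈ Icc (0 : ℝ) 1, ‖f s‖ ≤ F.embConst * ‖v s‖ * (‖w s‖ + B))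
    (ht : t ∈ Icc (0 : ℝ) 1) :
    ‖w t‖ + B ≤ (‖w 0‖ + B) * Real.exp (flowConst F v) := by
  refine ((h.mono h.left_mem ht ht.1).norm_add_le_mul_exp
    (intervalIntegrable_embConst_mul_norm hv ht) (fun s _ => embConst_mul_norm_nonneg F (v s))
    fun s hs => hf s (Icc_subset_Icc_right ht.2 hs)).trans ?_
  gcongr
  exact integral_embConst_mul_norm_le hv ht

theorem IsPrimitiveOn.norm_add_le_exp_flowConst_of_right (h : IsPrimitiveOn w f 0 1)
    (hv : Integrable v unitTime) (hB : 0 ≤ B)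
    (hf : ∀ s ∈ Icc (0 : ℝ) 1, ‖f s‖ ≤ F.embConst * ‖v s‖ * (‖w s‖ + B))
    (ht : t ∈ Icc (0 : ℝ) 1) :
    ‖w 0‖ + B ≤ (‖w t‖ + B) * Real.exp (flowConst F v) := by
  refine ((h.mono h.left_mem ht ht.1).norm_add_le_mul_exp_of_right
    (intervalIntegrable_embConst_mul_norm hv ht) (fun s _ => embConst_mul_norm_nonneg F (v s))
    fun s hs => hf s (Icc_subset_Icc_right ht.2 hs)).trans ?_
  gcongr
  exact integral_embConst_mul_norm_le hv ht

end

namespace IsFlow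

variable {F : FieldSpace n V} {v : ℝ → V} {φ : ℝ → E n → E n} {t : ℝ}

theorem apply_zero (h : IsFlow F v φ) (x : E n) : φ 0 x = x := by
  simpa using (h x).2 0 (by simp)

theorem isPrimitiveOn (h : IsFlow F v φ) (hv : Integrable v unitTime) (x : E n) :
    IsPrimitiveOn (fun t => φ t x) (fun s => F.field (v s) (φ s x)) 0 1 where
  le := zero_le_one
  intervalIntegrable := intervalIntegrable_iff_integrable_unitTime.2
    (F.integrable_field_comp hv (h x).1)
  apply_eq t ht := by rw [h.apply_zero, (h x).2 t ht]

theorem of_isPrimitiveOn (h0 : ∀ x, φ 0 x = x)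
    (h : ∀ x, IsPrimitiveOn (fun t => φ t x) (fun s => F.field (v s) (φ s x)) 0 1) :
    IsFlow F v φ := fun x =>
  ⟨(h x).continuousOn, fun t ht => by simpa only [h0] using (h x).apply_eq t ht⟩

theorem norm_apply_sub_le (h : IsFlow F v φ) (hv : Integrable v unitTime)
    (ht : t ∈ Icc (0 : ℝ) 1) (x : E n) : ‖φ t x - x‖ ≤ flowConst F v := by
  have hprim := (h.isPrimitiveOn hv x).mono (left_mem_Icc.2 zero_le_one) ht ht.1
  simpa only [h.apply_zero] using (hprim.norm_sub_le (intervalIntegrable_embConst_mul_norm hv ht)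
    fun s => F.norm_field_le (v s) (φ s x)).trans (integral_embConst_mul_norm_le hv ht)

theorem norm_sub_le (h : IsFlow F v φ) (hv : Integrable v unitTime)
    (ht : t ∈ Icc (0 : ℝ) 1) (x y : E n) :
    ‖φ t x - φ t y‖ ≤ Real.exp (flowConst F v) * ‖x - y‖ := by
  have := ((h.isPrimitiveOn hv x).sub (h.isPrimitiveOn hv y)).norm_add_le_exp_flowConst (F := F)
    hv le_rfl (fun s _ => by simpa using F.norm_field_sub_le (v s) (φ s x) (φ s y)) ht
  simpa only [h.apply_zero, add_zero, mul_comm] using this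

theorem norm_sub_le_of_apply (h : IsFlow F v φ) (hv : Integrable v unitTime)
    (ht : t ∈ Icc (0 : ℝ) 1) (x y : E n) :
    ‖x - y‖ ≤ Real.exp (flowConst F v) * ‖φ t x - φ t y‖ := by
  have := ((h.isPrimitiveOn hv x).sub
    (h.isPrimitiveOn hv y)).norm_add_le_exp_flowConst_of_right (F := F)
    hv le_rfl (fun s _ => by simpa using F.norm_field_sub_le (v s) (φ s x) (φ s y)) ht
  simpa only [h.apply_zero, add_zero, mul_comm] using this

theorem norm_displacement_sub_le (h : IsFlow F v φ) (hv : Integrable v unitTime)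
    (ht : t ∈ Icc (0 : ℝ) 1) (x y : E n) :
    ‖φ t x - φ t y - (x - y)‖ ≤ (Real.exp (flowConst F v) - 1) * ‖x - y‖ := by
  have hprim := ((h.isPrimitiveOn hv x).sub (h.isPrimitiveOn hv y)).sub_const (x - y)
  have := hprim.norm_add_le_exp_flowConst (F := F) hv (norm_nonneg (x - y)) (fun s _ => ?_) ht
  · simp only [h.apply_zero, sub_self, norm_zero, zero_add] at this
    linarith
  · refine (F.norm_field_sub_le (v s) (φ s x) (φ s y)).trans
      (mul_le_mul_of_nonneg_left ?_ (embConst_mul_norm_nonneg F (v s)))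
    simpa using norm_add_le (φ s x - φ s y - (x - y)) (x - y)

theorem norm_secondDiff_le (h : IsFlow F v φ) (hv : Integrable v unitTime)
    (ht : t ∈ Icc (0 : ℝ) 1) (x p q : E n) :
    ‖φ t (x + p + q) - φ t (x + p) - φ t (x + q) + φ t x‖ ≤
      (Real.exp (flowConst F v) ^ 2 * (Real.exp (flowConst F v) - 1)) * ‖p‖ * ‖q‖ := by
  set K := Real.exp (flowConst F v)
  have hprim := ((h.isPrimitiveOn hv (x + p + q)).sub (h.isPrimitiveOn hv (x + p))).sub
    ((h.isPrimitiveOn hv (x + q)).sub (h.isPrimitiveOn hv x))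
  have hB : 0 ≤ K * ‖p‖ * (K * ‖q‖) := by positivity
  have := hprim.norm_add_le_exp_flowConst (F := F) hv hB (fun s hs => ?_) ht
  · have hinit : x + p + q - (x + p) - (x + q - x) = 0 := by abel
    simp only [h.apply_zero, hinit, norm_zero, zero_add] at this
    rw [sub_sub_eq_add_sub, add_sub_right_comm] at this
    linarith
  · refine (F.norm_field_alternating_sum_le (v s) _ _ _ _).trans
      (mul_le_mul_of_nonneg_left ?_ (embConst_mul_norm_nonneg F (v s)))
    have hp : ‖φ s (x + p) - φ s x‖ ≤ K * ‖p‖ := by simpa using h.norm_sub_le hv hs (x + p) x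
    have hq : ‖φ s (x + q) - φ s x‖ ≤ K * ‖q‖ := by simpa using h.norm_sub_le hv hs (x + q) x
    gcongr

end IsFlow

end Flow

/-- A `C¹`-diffeomorphism of `ℝⁿ`, encoded as a homeomorphism of class `C¹` with injective
derivatives so that no inverse has to be carried along. -/
structure IsDiffeo {n : ℕ} (f : E n → E n) : Prop where
  contDiff : ContDiff ℝ 1 f
  isHomeomorph : IsHomeomorph f
  injective_fderiv : ∀ x, Function.Injective (fderiv ℝ f x)

theorem isOpenMap_of_injective_fderiv {X : Type*} [NormedAddCommGroup X] [NormedSpace ℝ X]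
    [FiniteDimensional ℝ X] {f : X → X} (hf : ContDiff ℝ 1 f)
    (hinj : ∀ x, Function.Injective (fderiv ℝ f x)) : IsOpenMap f := by
  have : CompleteSpace X := FiniteDimensional.complete ℝ X
  refine isOpenMap_of_hasStrictFDerivAt_equiv (f' := fun x =>
    (LinearEquiv.ofInjectiveEndo _ (hinj x)).toContinuousLinearEquiv) fun x => ?_
  convert hf.contDiffAt.hasStrictFDerivAt one_ne_zero using 1
  ext1 e
  rfl

/-- The image is open because the derivatives are invertible, and closed because `f` does not
contract distances too much. -/
theorem isDiffeo_of_bounds {n : ℕ} {f : E n → E n} {L K C : ℝ}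
    (hL : ∀ x y, ‖f x - f y‖ ≤ L * ‖x - y‖) (hK : ∀ x y, ‖x - y‖ ≤ K * ‖f x - f y‖)
    (hC : ∀ x p q, ‖f (x + p + q) - f (x + p) - f (x + q) + f x‖ ≤ C * ‖p‖ * ‖q‖) :
    IsDiffeo f := by
  have hcd := contDiff_one_of_secondDiff_le hL hC
  have hinj : ∀ x, Function.Injective (fderiv ℝ f x) := fun x =>
    injective_of_norm_le_mul_norm_apply
      (norm_le_mul_norm_fderiv_apply hK (hcd.differentiable one_ne_zero x))
  have hopen : IsOpenMap f := isOpenMap_of_injective_fderiv hcd hinj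
  have hanti : AntilipschitzWith K.toNNReal f := AntilipschitzWith.of_le_mul_dist fun x y => by
    rw [dist_eq_norm, dist_eq_norm]
    exact (hK x y).trans (by gcongr; exact Real.le_coe_toNNReal K)
  have hlip : LipschitzWith L.toNNReal f := LipschitzWith.of_dist_le' fun x y => by
    simpa only [dist_eq_norm] using hL x y
  have hrange : range f = univ := IsClopen.eq_univ
    ⟨hanti.isClosed_range hlip.uniformContinuous, hopen.isOpen_range⟩ (range_nonempty f)
  exact ⟨hcd, ⟨hcd.continuous, hopen, hanti.injective, range_eq_univ.1 hrange⟩, hinj⟩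

namespace IsFlow

variable {n : ℕ} {V : Type*} [NormedAddCommGroup V] [InnerProductSpace ℝ V]
  {F : FieldSpace n V} {v : ℝ → V} {φ : ℝ → E n → E n} {t : ℝ}

theorem isDiffeo (h : IsFlow F v φ) (hv : Integrable v unitTime) (ht : t ∈ Icc (0 : ℝ) 1) :
    IsDiffeo (φ t) :=
  isDiffeo_of_bounds (h.norm_sub_le hv ht) (h.norm_sub_le_of_apply hv ht)
    (h.norm_secondDiff_le hv ht)

theorem norm_fderiv_apply_le (h : IsFlow F v φ) (hv : Integrable v unitTime)
    (ht : t ∈ Icc (0 : ℝ) 1) (x e : E n) :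
    ‖fderiv ℝ (φ t) x e‖ ≤ Real.exp (flowConst F v) * ‖e‖ :=
  (fderiv ℝ (φ t) x).le_of_opNorm_le
    (norm_fderiv_le_of_norm_sub_le (Real.exp_nonneg _) (h.norm_sub_le hv ht) x) e

theorem norm_le_norm_fderiv_apply (h : IsFlow F v φ) (hv : Integrable v unitTime)
    (ht : t ∈ Icc (0 : ℝ) 1) (x e : E n) :
    ‖e‖ ≤ Real.exp (flowConst F v) * ‖fderiv ℝ (φ t) x e‖ :=
  norm_le_mul_norm_fderiv_apply (h.norm_sub_le_of_apply hv ht)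
    ((h.isDiffeo hv ht).contDiff.differentiable one_ne_zero x) e

theorem norm_fderiv_sub_id_le (h : IsFlow F v φ) (hv : Integrable v unitTime)
    (ht : t ∈ Icc (0 : ℝ) 1) (x : E n) :
    ‖fderiv ℝ (φ t) x - ContinuousLinearMap.id ℝ (E n)‖ ≤ Real.exp (flowConst F v) - 1 := by
  have hderiv : HasFDerivAt (fun z => φ t z - z)
      (fderiv ℝ (φ t) x - ContinuousLinearMap.id ℝ (E n)) x :=
    ((h.isDiffeo hv ht).contDiff.differentiable one_ne_zero x).hasFDerivAt.fun_sub
      (hasFDerivAt_id x)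
  rw [← hderiv.fderiv]
  refine norm_fderiv_le_of_norm_sub_le (sub_nonneg.2 (Real.one_le_exp (flowConst_nonneg F v)))
    (fun y z => ?_) x
  rw [sub_sub_sub_comm]
  exact h.norm_displacement_sub_le hv ht y z

end IsFlow

/-! ### The oriented Grassmannian -/

section Grassmannian

variable {n d : ℕ}

theorem linearIndependent_iff_frameVolume_ne_zero {u : Fin d → E n} :
    LinearIndependent ℝ u ↔ frameVolume u ≠ 0 := by
  have h := Matrix.posSemidef_gram ℝ u
  rw [frameVolume, Real.sqrt_ne_zero h.det_nonneg, ← h.posDef_iff_det_ne_zero,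
    Matrix.posDef_gram_iff_linearIndependent]

theorem frameVolume_pos {u : Fin d → E n} (hu : LinearIndependent ℝ u) : 0 < frameVolume u :=
  lt_of_le_of_ne (Real.sqrt_nonneg _) (linearIndependent_iff_frameVolume_ne_zero.1 hu).symm

theorem continuous_frameVolume : Continuous (frameVolume : (Fin d → E n) → ℝ) := by
  refine Real.continuous_sqrt.comp (Continuous.matrix_det ?_)
  refine continuous_matrix fun i j => ?_
  simp only [Matrix.gram_apply]
  fun_prop

/-- The oriented subspace spanned by a frame, i.e. the quotient map onto the oriented
Grassmannian. -/
def orientedSpan (u : Frame n d) : OrientedGrassmannian n d := Quotient.mk (frameSetoid n d) u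

/-- The action on frames of the matrices of positive determinant, whose orbits are the oriented
subspaces. -/
def frameAct (A : Matrix (Fin d) (Fin d) ℝ) (hA : 0 < A.det) (u : Frame n d) : Frame n d :=
  ⟨fun i => ∑ j, A i j • u.1 j, by
    rw [linearIndependent_iff_frameVolume_ne_zero, frameVolume_comp fun _ => rfl]
    exact mul_ne_zero (abs_ne_zero.2 hA.ne') (frameVolume_pos u.2).ne'⟩

theorem continuous_frameAct (A : Matrix (Fin d) (Fin d) ℝ) (hA : 0 < A.det) :
    Continuous (frameAct (n := n) A hA) := by
  refine Continuous.subtype_mk (continuous_pi fun i => ?_) _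
  exact continuous_finsetSum _ fun j _ =>
    ((continuous_apply j).comp continuous_subtype_val).const_smul (A i j)

theorem isOpenQuotientMap_orientedSpan :
    IsOpenQuotientMap (orientedSpan : Frame n d → OrientedGrassmannian n d) := by
  refine ⟨Quotient.mk_surjective, continuous_quot_mk, fun O hO => ?_⟩
  have hset : orientedSpan ⁻¹' (orientedSpan '' O) =
      ⋃ (A : Matrix (Fin d) (Fin d) ℝ) (hA : 0 < A.det), frameAct A hA ⁻¹' O := by
    ext w
    simp only [mem_preimage, mem_image, mem_iUnion]
    constructor
    · rintro ⟨u, hu, huw⟩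
      obtain ⟨A, hA, h⟩ := Quotient.exact huw.symm
      refine ⟨A, hA, ?_⟩
      have : frameAct A hA w = u := Subtype.ext (funext fun i => (h i).symm)
      rwa [this]
    · rintro ⟨A, hA, h⟩
      exact ⟨_, h, (Quotient.sound ⟨A, hA, fun i => rfl⟩ :
        orientedSpan w = orientedSpan (frameAct A hA w)).symm⟩
  change IsOpen (orientedSpan ⁻¹' (orientedSpan '' O))
  rw [hset]
  exact isOpen_iUnion fun A => isOpen_iUnion fun hA => hO.preimage (continuous_frameAct A hA)

theorem surjective_orientedSpan :
    Function.Surjective (orientedSpan : Frame n d → OrientedGrassmannian n d) :=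
  isOpenQuotientMap_orientedSpan.surjective

/-- The image of a frame under an injective linear map. -/
def mapFrame (L : E n →L[ℝ] E n) (hL : Function.Injective L) (u : Frame n d) : Frame n d :=
  ⟨fun i => L (u.1 i), u.2.map' (L : E n →ₗ[ℝ] E n) (LinearMap.ker_eq_bot.mpr hL)⟩

theorem transport_orientedSpan {L : E n →L[ℝ] E n} (hL : Function.Injective L) (u : Frame n d) :
    transport L (orientedSpan u) = orientedSpan (mapFrame L hL u) :=
  dif_pos hL

theorem jacobian_orientedSpan (L : E n →L[ℝ] E n) (u : Frame n d) :
    jacobian L (orientedSpan u) = frameVolume (fun i => L (u.1 i)) / frameVolume u.1 := rfl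

theorem jacobian_pos {L : E n →L[ℝ] E n} (hL : Function.Injective L)
    (U : OrientedGrassmannian n d) : 0 < jacobian L U := by
  obtain ⟨u, rfl⟩ := surjective_orientedSpan U
  exact div_pos (frameVolume_pos (mapFrame L hL u).2) (frameVolume_pos u.2)

theorem transport_comp {L M : E n →L[ℝ] E n} (hL : Function.Injective L)
    (hM : Function.Injective M) (U : OrientedGrassmannian n d) :
    transport (M.comp L) U = transport M (transport L U) := by
  obtain ⟨u, rfl⟩ := surjective_orientedSpan U
  have hML : Function.Injective (M.comp L) := hM.comp hL
  rw [transport_orientedSpan hL, transport_orientedSpan hM, transport_orientedSpan hML]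
  rfl

theorem jacobian_comp {L M : E n →L[ℝ] E n} (hL : Function.Injective L)
    (U : OrientedGrassmannian n d) :
    jacobian (M.comp L) U = jacobian M (transport L U) * jacobian L U := by
  obtain ⟨u, rfl⟩ := surjective_orientedSpan U
  rw [transport_orientedSpan hL, jacobian_orientedSpan, jacobian_orientedSpan,
    jacobian_orientedSpan]
  exact (div_mul_div_cancel₀ (frameVolume_pos (mapFrame L hL u).2).ne').symm

theorem transport_id (U : OrientedGrassmannian n d) :
    transport (ContinuousLinearMap.id ℝ (E n)) U = U := by
  obtain ⟨u, rfl⟩ := surjective_orientedSpan U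
  rw [transport_orientedSpan fun _ _ h => h]
  rfl

theorem jacobian_id (U : OrientedGrassmannian n d) :
    jacobian (ContinuousLinearMap.id ℝ (E n)) U = 1 := by
  obtain ⟨u, rfl⟩ := surjective_orientedSpan U
  exact div_self (frameVolume_pos u.2).ne'

theorem continuous_apply_frame {X : Type*} [TopologicalSpace X] {L : X → E n →L[ℝ] E n}
    (hL : Continuous L) : Continuous fun p : X × Frame n d => fun i => L p.1 (p.2.1 i) :=
  continuous_pi fun i => (hL.comp continuous_fst).clm_apply
    ((continuous_apply i).comp (continuous_subtype_val.comp continuous_snd))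

theorem continuous_transport {X : Type*} [TopologicalSpace X] {L : X → E n →L[ℝ] E n}
    (hL : Continuous L) (hinj : ∀ x, Function.Injective (L x)) :
    Continuous fun p : X × OrientedGrassmannian n d => transport (L p.1) p.2 := by
  have hq := (IsOpenQuotientMap.id (X := X)).prodMap
    (isOpenQuotientMap_orientedSpan (n := n) (d := d))
  rw [hq.isQuotientMap.continuous_iff]
  have : (fun p : X × OrientedGrassmannian n d => transport (L p.1) p.2) ∘
      Prod.map id orientedSpan =
      fun p : X × Frame n d => orientedSpan (mapFrame (L p.1) (hinj p.1) p.2) :=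
    funext fun p => transport_orientedSpan (hinj p.1) p.2
  rw [this]
  exact isOpenQuotientMap_orientedSpan.continuous.comp
    (Continuous.subtype_mk (continuous_apply_frame hL) _)

theorem continuous_jacobian {X : Type*} [TopologicalSpace X] {L : X → E n →L[ℝ] E n}
    (hL : Continuous L) :
    Continuous fun p : X × OrientedGrassmannian n d => jacobian (L p.1) p.2 := by
  have hq := (IsOpenQuotientMap.id (X := X)).prodMap
    (isOpenQuotientMap_orientedSpan (n := n) (d := d))
  rw [hq.isQuotientMap.continuous_iff]
  change Continuous fun p : X × Frame n d =>
    frameVolume (fun i => L p.1 (p.2.1 i)) / frameVolume p.2.1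
  refine Continuous.div (continuous_frameVolume.comp (continuous_apply_frame hL))
    (continuous_frameVolume.comp (continuous_subtype_val.comp continuous_snd))
    fun p => (frameVolume_pos p.2.2).ne'

theorem tendsto_apply_frame {ι : Type*} {l : Filter ι} {L : ι → E n →L[ℝ] E n}
    {M : E n →L[ℝ] E n} (hL : Tendsto L l (𝓝 M)) (u : Frame n d) :
    Tendsto (fun i j => L i (u.1 j)) l (𝓝 fun j => M (u.1 j)) :=
  tendsto_pi_nhds.2 fun j =>
    ((ContinuousLinearMap.apply ℝ (E n) (u.1 j)).continuous.tendsto _).comp hL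

theorem tendsto_transport {ι : Type*} {l : Filter ι} {L : ι → E n →L[ℝ] E n}
    {M : E n →L[ℝ] E n} (hL : Tendsto L l (𝓝 M)) (hinj : ∀ i, Function.Injective (L i))
    (hM : Function.Injective M) (U : OrientedGrassmannian n d) :
    Tendsto (fun i => transport (L i) U) l (𝓝 (transport M U)) := by
  obtain ⟨u, rfl⟩ := surjective_orientedSpan U
  simp only [transport_orientedSpan (hinj _), transport_orientedSpan hM]
  exact (isOpenQuotientMap_orientedSpan.continuous.tendsto _).comp
    (tendsto_subtype_rng.2 (tendsto_apply_frame hL u))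

theorem tendsto_jacobian {ι : Type*} {l : Filter ι} {L : ι → E n →L[ℝ] E n}
    {M : E n →L[ℝ] E n} (hL : Tendsto L l (𝓝 M)) (U : OrientedGrassmannian n d) :
    Tendsto (fun i => jacobian (L i) U) l (𝓝 (jacobian M U)) := by
  obtain ⟨u, rfl⟩ := surjective_orientedSpan U
  simp only [jacobian_orientedSpan]
  exact ((continuous_frameVolume.tendsto _).comp (tendsto_apply_frame hL u)).div_const _

theorem exists_orthonormal_comp (u : Frame n d) :
    ∃ (w : Fin d → E n) (A : Matrix (Fin d) (Fin d) ℝ), Orthonormal ℝ w ∧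
      ∀ i, w i = ∑ j, A i j • u.1 j := by
  set S := Submodule.span ℝ (range u.1)
  have hS : Module.finrank ℝ S = d := by simpa using finrank_span_eq_card u.2
  let b := (stdOrthonormalBasis ℝ S).reindex (finCongr hS)
  have hb : ∀ i, ∃ c : Fin d → ℝ, ∑ j, c j • u.1 j = (b i : E n) := fun i =>
    (Submodule.mem_span_range_iff_exists_fun ℝ).1 (b i).2
  choose A hA using hb
  exact ⟨fun i => b i, A, b.orthonormal.comp_linearIsometry S.subtypeₗᵢ, fun i => (hA i).symm⟩

theorem frameVolume_of_orthonormal {w : Fin d → E n} (hw : Orthonormal ℝ w) :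
    frameVolume w = 1 := by
  have : Matrix.gram ℝ w = 1 := by
    ext i j
    rw [Matrix.gram_apply, orthonormal_iff_ite.1 hw, Matrix.one_apply]
  rw [frameVolume, this, Matrix.det_one, Real.sqrt_one]

theorem jacobian_orientedSpan_of_orthonormal (L : E n →L[ℝ] E n) {u : Frame n d}
    {w : Fin d → E n} {A : Matrix (Fin d) (Fin d) ℝ} (hw : Orthonormal ℝ w)
    (hA : ∀ i, w i = ∑ j, A i j • u.1 j) :
    jacobian L (orientedSpan u) = frameVolume fun i => L (w i) := by
  have hdet := frameVolume_comp hA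
  have himage := frameVolume_comp (A := A) (u := fun j => L (u.1 j)) (w := fun i => L (w i))
    fun i => by simp [hA i]
  rw [frameVolume_of_orthonormal hw] at hdet
  rw [jacobian_orientedSpan, himage, div_eq_iff (frameVolume_pos u.2).ne']
  linear_combination (frameVolume fun i => L (u.1 i)) * hdet

/-- A bound on the volume of the parallelepiped spanned by `d` vectors of norm at most `K`, hence on
the Jacobian of a linear map of norm at most `K`; it is not the optimal constant `K ^ d`, but the
one given by the Leibniz expansion of the Gram determinant. -/
def jacobianBound (d : ℕ) (K : ℝ) : ℝ := Real.sqrt (d.factorial * (K ^ 2) ^ d)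

theorem frameVolume_le_jacobianBound {w : Fin d → E n} {K : ℝ} (hw : ∀ i, ‖w i‖ ≤ K) :
    frameVolume w ≤ jacobianBound d K := by
  have hgram : ∀ i j, |Matrix.gram ℝ w i j| ≤ K ^ 2 := fun i j => by
    rw [Matrix.gram_apply, sq]
    exact (abs_real_inner_le_norm _ _).trans
      (mul_le_mul (hw i) (hw j) (norm_nonneg _) ((norm_nonneg _).trans (hw i)))
  refine Real.sqrt_le_sqrt ((le_abs_self _).trans ?_)
  simpa [nsmul_eq_mul] using Matrix.det_le (abv := AbsoluteValue.abs) hgram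

theorem jacobian_le {L : E n →L[ℝ] E n} {K : ℝ} (hL : ∀ e, ‖L e‖ ≤ K * ‖e‖)
    (U : OrientedGrassmannian n d) : jacobian L U ≤ jacobianBound d K := by
  obtain ⟨u, rfl⟩ := surjective_orientedSpan U
  obtain ⟨w, A, hw, hA⟩ := exists_orthonormal_comp u
  rw [jacobian_orientedSpan_of_orthonormal L hw hA]
  exact frameVolume_le_jacobianBound fun i => by simpa only [hw.1 i, mul_one] using hL (w i)

theorem one_le_jacobianBound_mul {L : E n →L[ℝ] E n} {K : ℝ} (hL : ∀ e, ‖e‖ ≤ K * ‖L e‖)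
    (U : OrientedGrassmannian n d) : 1 ≤ jacobianBound d K * jacobian L U := by
  have hinj : Function.Injective L := injective_of_norm_le_mul_norm_apply hL
  let e := (LinearEquiv.ofInjectiveEndo (L : E n →ₗ[ℝ] E n) hinj).toContinuousLinearEquiv
  have he : ∀ x, e x = L x := fun x => rfl
  have hcomp : (e.symm : E n →L[ℝ] E n).comp L = ContinuousLinearMap.id ℝ (E n) := by
    ext1 x
    simp [← he]
  have hjac := jacobian_comp (M := (e.symm : E n →L[ℝ] E n)) hinj U
  rw [hcomp, jacobian_id] at hjac
  rw [hjac]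
  refine mul_le_mul_of_nonneg_right (jacobian_le (fun y => ?_) _) (jacobian_pos hinj U).le
  have := hL (e.symm y)
  rwa [← he, e.apply_symm_apply] at this

end Grassmannian

/-! ### Pushforward and rescaling of varifolds -/

theorem map_withDensity_comp {α β : Type*} [MeasurableSpace α] [MeasurableSpace β]
    {m : Measure α} {T : α → β} (hT : Measurable T) {g : β → ℝ≥0∞}
    (hg : AEMeasurable g (m.map T)) :
    (m.withDensity fun p => g (T p)).map T = (m.map T).withDensity g := by
  ext s hs
  have hg' : AEMeasurable g ((m.restrict (T ⁻¹' s)).map T) := by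
    rw [← Measure.restrict_map hT hs]
    exact hg.restrict
  rw [Measure.map_apply hT hs, withDensity_apply _ (hT hs), withDensity_apply _ hs,
    Measure.restrict_map hT hs, lintegral_map' hg' hT.aemeasurable]

section Pushforward

variable {n d : ℕ} {φ ψ : E n → E n}

theorem IsDiffeo.differentiable (hφ : IsDiffeo φ) : Differentiable ℝ φ :=
  hφ.contDiff.differentiable one_ne_zero

theorem IsDiffeo.fderiv_comp (hψ : IsDiffeo ψ) (hφ : IsDiffeo φ) (x : E n) :
    fderiv ℝ (ψ ∘ φ) x = (fderiv ℝ ψ (φ x)).comp (fderiv ℝ φ x) :=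
  _root_.fderiv_comp x (hψ.differentiable _) (hφ.differentiable _)

theorem IsDiffeo.comp (hψ : IsDiffeo ψ) (hφ : IsDiffeo φ) : IsDiffeo (ψ ∘ φ) where
  contDiff := hψ.contDiff.comp hφ.contDiff
  isHomeomorph := hψ.isHomeomorph.comp hφ.isHomeomorph
  injective_fderiv x := by
    rw [hψ.fderiv_comp hφ]
    exact (hψ.injective_fderiv _).comp (hφ.injective_fderiv _)

theorem IsDiffeo.measurableEmbedding (hφ : IsDiffeo φ) : MeasurableEmbedding φ :=
  hφ.isHomeomorph.isClosedEmbedding.measurableEmbedding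

theorem IsDiffeo.invFun_apply (hφ : IsDiffeo φ) (x : E n) : Function.invFun φ (φ x) = x :=
  Function.leftInverse_invFun hφ.isHomeomorph.injective x

theorem IsDiffeo.apply_invFun (hφ : IsDiffeo φ) (x : E n) : φ (Function.invFun φ x) = x :=
  Function.rightInverse_invFun hφ.isHomeomorph.surjective x

theorem IsDiffeo.invFun_comp (hψ : IsDiffeo ψ) (hφ : IsDiffeo φ) (y : E n) :
    Function.invFun (ψ ∘ φ) y = Function.invFun φ (Function.invFun ψ y) := by
  obtain ⟨x, rfl⟩ := (hψ.comp hφ).isHomeomorph.surjective y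
  rw [(hψ.comp hφ).invFun_apply, Function.comp_apply, hψ.invFun_apply, hφ.invFun_apply]

/-- The action `(x, U) ↦ (φ x, d_xφ · U)` of a diffeomorphism on oriented planes. -/
def pushMap (φ : E n → E n) (p : E n × OrientedGrassmannian n d) :
    E n × OrientedGrassmannian n d :=
  (φ p.1, transport (fderiv ℝ φ p.1) p.2)

/-- The Jacobian of a diffeomorphism along oriented planes, as an extended nonnegative real. -/
def pushDensity (φ : E n → E n) (p : E n × OrientedGrassmannian n d) : ℝ≥0∞ :=
  ENNReal.ofReal (jacobian (fderiv ℝ φ p.1) p.2)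

theorem pushforward_eq (φ : E n → E n) (μ : Measure (E n × OrientedGrassmannian n d)) :
    pushforward φ μ = (μ.withDensity (pushDensity φ)).map (pushMap φ) := rfl

theorem IsDiffeo.measurable_pushMap (hφ : IsDiffeo φ) :
    Measurable (pushMap φ : E n × OrientedGrassmannian n d → _) :=
  (hφ.contDiff.continuous.measurable.comp measurable_fst).prodMk
    (continuous_transport (hφ.contDiff.continuous_fderiv one_ne_zero)
      hφ.injective_fderiv).measurable

theorem IsDiffeo.measurable_pushDensity (hφ : IsDiffeo φ) :
    Measurable (pushDensity φ : E n × OrientedGrassmannian n d → _) :=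
  (continuous_jacobian (hφ.contDiff.continuous_fderiv one_ne_zero)).measurable.ennreal_ofReal

theorem IsDiffeo.pushDensity_ne_zero (hφ : IsDiffeo φ) (p : E n × OrientedGrassmannian n d) :
    pushDensity φ p ≠ 0 :=
  (ENNReal.ofReal_pos.2 (jacobian_pos (hφ.injective_fderiv _) _)).ne'

theorem IsDiffeo.pushMap_comp (hψ : IsDiffeo ψ) (hφ : IsDiffeo φ)
    (p : E n × OrientedGrassmannian n d) : pushMap (ψ ∘ φ) p = pushMap ψ (pushMap φ p) := by
  simp only [pushMap, hψ.fderiv_comp hφ, Function.comp_apply]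
  rw [transport_comp (hφ.injective_fderiv _) (hψ.injective_fderiv _)]

theorem IsDiffeo.pushDensity_comp (hψ : IsDiffeo ψ) (hφ : IsDiffeo φ)
    (p : E n × OrientedGrassmannian n d) :
    pushDensity (ψ ∘ φ) p = pushDensity φ p * pushDensity ψ (pushMap φ p) := by
  simp only [pushDensity, pushMap, hψ.fderiv_comp hφ]
  rw [jacobian_comp (hφ.injective_fderiv _), mul_comm,
    ENNReal.ofReal_mul (jacobian_pos (hφ.injective_fderiv _) _).le]

theorem pushMap_id (p : E n × OrientedGrassmannian n d) : pushMap id p = p := by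
  simp [pushMap, transport_id]

theorem pushDensity_id (p : E n × OrientedGrassmannian n d) : pushDensity id p = 1 := by
  simp [pushDensity, jacobian_id]

variable {μ : Measure (E n × OrientedGrassmannian n d)}

theorem pushforward_id : pushforward id μ = μ := by
  have h1 : (pushMap id : E n × OrientedGrassmannian n d → _) = id := funext pushMap_id
  have h2 : (pushDensity id : E n × OrientedGrassmannian n d → _) = 1 := funext pushDensity_id
  rw [pushforward_eq, h1, h2, withDensity_one, Measure.map_id]

theorem IsDiffeo.pushforward_comp (hψ : IsDiffeo ψ) (hφ : IsDiffeo φ) :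
    pushforward (ψ ∘ φ) μ = pushforward ψ (pushforward φ μ) := by
  have h1 : (pushMap (ψ ∘ φ) : E n × OrientedGrassmannian n d → _) = pushMap ψ ∘ pushMap φ :=
    funext fun p => hψ.pushMap_comp hφ p
  have h2 : (pushDensity (ψ ∘ φ) : E n × OrientedGrassmannian n d → _) =
      pushDensity φ * fun p => pushDensity ψ (pushMap φ p) :=
    funext fun p => hψ.pushDensity_comp hφ p
  rw [pushforward_eq, pushforward_eq, pushforward_eq, h1, h2,
    ← Measure.map_map hψ.measurable_pushMap hφ.measurable_pushMap,
    withDensity_mul μ hφ.measurable_pushDensity (g := fun p => pushDensity ψ (pushMap φ p))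
      (hψ.measurable_pushDensity.comp hφ.measurable_pushMap),
    map_withDensity_comp hφ.measurable_pushMap hψ.measurable_pushDensity.aemeasurable]

/-- The weight of `μ` with density the Jacobian of `φ`; it is the weight of `φ_# μ` pulled back
by `φ`. -/
def tilt (φ : E n → E n) (μ : Measure (E n × OrientedGrassmannian n d)) : Measure (E n) :=
  weight (μ.withDensity (pushDensity φ))

theorem IsDiffeo.weight_pushforward (hφ : IsDiffeo φ) :
    weight (pushforward φ μ) = (tilt φ μ).map φ := by
  rw [tilt, weight, weight, pushforward_eq, Measure.map_map measurable_fst hφ.measurable_pushMap,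
    Measure.map_map hφ.measurableEmbedding.measurable measurable_fst]
  rfl

theorem tilt_absolutelyContinuous : tilt φ μ ≪ weight μ :=
  (withDensity_absolutelyContinuous _ _).map measurable_fst

theorem IsDiffeo.absolutelyContinuous_tilt (hφ : IsDiffeo φ) : weight μ ≪ tilt φ μ :=
  (withDensity_absolutelyContinuous' hφ.measurable_pushDensity.aemeasurable
    (Eventually.of_forall hφ.pushDensity_ne_zero)).map measurable_fst

theorem IsDiffeo.ae_weight_pushforward_iff (hφ : IsDiffeo φ) {P : E n → Prop} :
    (∀ᵐ y ∂weight (pushforward φ μ), P y) ↔ ∀ᵐ x ∂weight μ, P (φ x) := by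
  rw [hφ.weight_pushforward, hφ.measurableEmbedding.ae_map_iff]
  exact ⟨fun h => hφ.absolutelyContinuous_tilt.ae_le h,
    fun h => tilt_absolutelyContinuous.ae_le h⟩

theorem IsDiffeo.aemeasurable_comp_invFun (hφ : IsDiffeo φ) {a : E n → ℝ}
    (ha : AEMeasurable a (weight μ)) :
    AEMeasurable (fun y => a (Function.invFun φ y)) (weight (pushforward φ μ)) := by
  rw [hφ.weight_pushforward, hφ.measurableEmbedding.aemeasurable_map_iff]
  refine (ha.mono_ac tilt_absolutelyContinuous).congr (Eventually.of_forall fun x => ?_)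
  simp [hφ.invFun_apply]

theorem IsDiffeo.lintegral_weight_pushforward (hφ : IsDiffeo φ) (f : E n → ℝ≥0∞) :
    ∫⁻ y, f (Function.invFun φ y) ∂weight (pushforward φ μ) = ∫⁻ x, f x ∂tilt φ μ := by
  rw [hφ.weight_pushforward, hφ.measurableEmbedding.lintegral_map]
  simp [hφ.invFun_apply]

theorem rescale_congr {a b : E n → ℝ} (h : a =ᵐ[weight μ] b) : rescale a μ = rescale b μ := by
  refine withDensity_congr_ae ?_
  filter_upwards [ae_of_ae_map measurable_fst.aemeasurable h] with p hp
  rw [hp]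

theorem rescale_rescale {a b : E n → ℝ} (ha : AEMeasurable a (weight μ))
    (hb : AEMeasurable b (weight μ)) (ha0 : ∀ x, 0 ≤ a x) :
    rescale b (rescale a μ) = rescale (fun x => a x * b x) μ := by
  have ha' : AEMeasurable (fun p : E n × OrientedGrassmannian n d => a p.1) μ :=
    ha.comp_measurable measurable_fst
  have hb' : AEMeasurable (fun p : E n × OrientedGrassmannian n d => b p.1) μ :=
    hb.comp_measurable measurable_fst
  rw [rescale, rescale, rescale, ← withDensity_mul₀ ha'.ennreal_ofReal hb'.ennreal_ofReal]
  congr 1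
  ext p
  exact (ENNReal.ofReal_mul (ha0 _)).symm

theorem weight_rescale {a : E n → ℝ} (ha : AEMeasurable a (weight μ)) :
    weight (rescale a μ) = (weight μ).withDensity fun x => ENNReal.ofReal (a x) :=
  map_withDensity_comp (g := fun x => ENNReal.ofReal (a x)) measurable_fst ha.ennreal_ofReal

theorem weight_rescale_absolutelyContinuous {a : E n → ℝ} : weight (rescale a μ) ≪ weight μ :=
  (withDensity_absolutelyContinuous _ _).map measurable_fst

theorem ae_weight_rescale_iff {a : E n → ℝ} (ha : AEMeasurable a (weight μ))
    (hpos : ∀ᵐ x ∂weight μ, 0 < a x) {P : E n → Prop} :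
    (∀ᵐ x ∂weight (rescale a μ), P x) ↔ ∀ᵐ x ∂weight μ, P x := by
  refine ⟨fun h => ?_, fun h => weight_rescale_absolutelyContinuous.ae_le h⟩
  rw [weight_rescale ha] at h
  refine (withDensity_absolutelyContinuous' ha.ennreal_ofReal ?_).ae_le h
  filter_upwards [hpos] with x hx
  exact (ENNReal.ofReal_pos.2 hx).ne'

theorem IsDiffeo.pushforward_rescale (hφ : IsDiffeo φ) {a : E n → ℝ}
    (ha : AEMeasurable a (weight μ)) :
    pushforward φ (rescale a μ) = rescale (fun y => a (Function.invFun φ y)) (pushforward φ μ) := by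
  have ha' : AEMeasurable (fun p : E n × OrientedGrassmannian n d => ENNReal.ofReal (a p.1)) μ :=
    (ha.comp_measurable measurable_fst).ennreal_ofReal
  have hJ : AEMeasurable (pushDensity φ) μ := hφ.measurable_pushDensity.aemeasurable
  have hinv : AEMeasurable (fun p : E n × OrientedGrassmannian n d =>
      ENNReal.ofReal (a (Function.invFun φ p.1)))
      ((μ.withDensity (pushDensity φ)).map (pushMap φ)) :=
    ((hφ.aemeasurable_comp_invFun ha).comp_measurable measurable_fst).ennreal_ofReal
  have hcomp : (fun p : E n × OrientedGrassmannian n d => ENNReal.ofReal (a p.1)) =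
      fun p => ENNReal.ofReal (a (Function.invFun φ (pushMap φ p).1)) := by
    ext p
    rw [pushMap, hφ.invFun_apply]
  rw [pushforward_eq, rescale, ← withDensity_mul₀ ha' hJ, mul_comm, withDensity_mul₀ hJ ha', hcomp,
    map_withDensity_comp hφ.measurable_pushMap hinv]
  rfl

theorem tilt_le {C : ℝ} (hC : ∀ p : E n × OrientedGrassmannian n d,
    jacobian (fderiv ℝ φ p.1) p.2 ≤ C) : tilt φ μ ≤ ENNReal.ofReal C • weight μ := by
  rw [tilt, weight, weight, ← Measure.map_smul, ← withDensity_const]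
  exact Measure.map_mono (withDensity_mono (Eventually.of_forall fun p =>
    ENNReal.ofReal_le_ofReal (hC p))) measurable_fst

theorem weight_le_smul_tilt {C : ℝ} (hC : ∀ p : E n × OrientedGrassmannian n d,
    1 ≤ C * jacobian (fderiv ℝ φ p.1) p.2) (hC0 : 0 ≤ C) :
    weight μ ≤ ENNReal.ofReal C • tilt φ μ := by
  rw [tilt, weight, weight, ← Measure.map_smul, ← withDensity_smul' _ _ ENNReal.ofReal_ne_top]
  refine Measure.map_mono ?_ measurable_fst
  conv_lhs => rw [← withDensity_one (μ := μ)]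
  refine withDensity_mono (Eventually.of_forall fun p => ?_)
  rw [Pi.smul_apply, smul_eq_mul, pushDensity, ← ENNReal.ofReal_mul hC0, Pi.one_apply,
    ← ENNReal.ofReal_one]
  exact ENNReal.ofReal_le_ofReal (hC p)

end Pushforward

/-! ### Time changes -/

section TimeChange

variable {l : ℝ}

theorem ae_unitTime_mem : ∀ᵐ t ∂unitTime, t ∈ Icc (0 : ℝ) 1 :=
  ae_restrict_mem measurableSet_Icc

theorem measurePreserving_one_sub : MeasurePreserving (fun t : ℝ => 1 - t) unitTime unitTime := by
  have h := (Measure.measurePreserving_sub_left (volume : Measure ℝ) 1).restrict_preimage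
    (s := Icc 0 1) measurableSet_Icc
  have hpre : (fun t : ℝ => 1 - t) ⁻¹' Icc 0 1 = Icc 0 1 := by
    ext t
    simp only [mem_preimage, mem_Icc]
    constructor <;> rintro ⟨h1, h2⟩ <;> constructor <;> linarith
  rwa [hpre] at h

theorem measurableEmbedding_one_sub : MeasurableEmbedding fun t : ℝ => 1 - t :=
  (Homeomorph.subLeft (1 : ℝ)).measurableEmbedding

theorem measurableEmbedding_sub_div (hl : l ≠ 0) (m : ℝ) :
    MeasurableEmbedding fun t : ℝ => (t - m) / l :=
  (measurableEmbedding_mulRight₀ (inv_ne_zero hl)).comp (measurableEmbedding_subRight m)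

theorem map_restrict_sub_div (hl : 0 < l) (m : ℝ) :
    (volume.restrict (Icc m (m + l))).map (fun t => (t - m) / l) =
      ENNReal.ofReal l • unitTime := by
  have hpre : Icc m (m + l) = (fun t => (t - m) / l) ⁻¹' Icc 0 1 := by
    ext t
    simp only [mem_preimage, mem_Icc, le_div_iff₀ hl, div_le_iff₀ hl]
    constructor <;> rintro ⟨h1, h2⟩ <;> constructor <;> linarith
  have hvol : (volume : Measure ℝ).map (fun t => (t - m) / l) = ENNReal.ofReal l • volume := by
    have : (fun t : ℝ => (t - m) / l) = (fun t => t * l⁻¹) ∘ fun t => t - m := rfl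
    rw [this, ← Measure.map_map (measurable_mul_const _) (measurable_sub_const _),
      (measurePreserving_sub_right volume m).map_eq,
      Real.map_volume_mul_right (inv_ne_zero hl.ne'), inv_inv, abs_of_pos hl]
  rw [hpre, ← (measurableEmbedding_sub_div hl.ne' m).restrict_map, hvol, Measure.restrict_smul,
    unitTime]

theorem lintegral_restrict_sub_div (hl : 0 < l) (m : ℝ) (f : ℝ → ℝ≥0∞) :
    ∫⁻ t in Icc m (m + l), f ((t - m) / l) = ENNReal.ofReal l * ∫⁻ t, f t ∂unitTime := by
  rw [← (measurableEmbedding_sub_div hl.ne' m).lintegral_map, map_restrict_sub_div hl,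
    lintegral_smul_measure, smul_eq_mul]

theorem quasiMeasurePreserving_sub_div (hl : 0 < l) (m : ℝ) :
    Measure.QuasiMeasurePreserving (fun t => (t - m) / l) (volume.restrict (Icc m (m + l)))
      unitTime := by
  refine ⟨(measurableEmbedding_sub_div hl.ne' m).measurable, ?_⟩
  rw [map_restrict_sub_div hl]
  exact Measure.smul_absolutelyContinuous

/-- The concatenation of two paths parametrized by `[0, 1]`, the first one run during `[0, l]` and
the second one during `[l, 1]`. At the junction the value is that of the first path. -/
def concat {G : Type*} (l : ℝ) (f g : ℝ → G) (t : ℝ) : G :=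
  if t ≤ l then f (t / l) else g ((t - l) / (1 - l))

theorem concat_of_le {G : Type*} {l t : ℝ} (f g : ℝ → G) (h : t ≤ l) :
    concat l f g t = f (t / l) := if_pos h

theorem concat_of_lt {G : Type*} {l t : ℝ} (f g : ℝ → G) (h : l < t) :
    concat l f g t = g ((t - l) / (1 - l)) := if_neg h.not_ge

theorem concat_of_ge {G : Type*} {l t : ℝ} {f g : ℝ → G} (hl : 0 < l) (hfg : f 1 = g 0)
    (h : l ≤ t) : concat l f g t = g ((t - l) / (1 - l)) := by
  rcases h.eq_or_lt with rfl | h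
  · rw [concat_of_le _ _ le_rfl, div_self hl.ne', sub_self, zero_div, hfg]
  · exact concat_of_lt _ _ h

theorem map_concat {G H : Type*} (A : G → H) (l : ℝ) (f g : ℝ → G) (t : ℝ) :
    A (concat l f g t) = concat l (fun s => A (f s)) (fun s => A (g s)) t := by
  unfold concat
  split_ifs <;> rfl

theorem map₂_concat {G G' H : Type*} (A : G → G' → H) (l : ℝ) (f g : ℝ → G) (f' g' : ℝ → G')
    (t : ℝ) : A (concat l f g t) (concat l f' g' t) =
      concat l (fun s => A (f s) (f' s)) (fun s => A (g s) (g' s)) t := by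
  unfold concat
  split_ifs <;> rfl

theorem unitTime_restrict_Iic (hl1 : l < 1) :
    unitTime.restrict (Iic l) = volume.restrict (Icc 0 (0 + l)) := by
  rw [unitTime, Measure.restrict_restrict measurableSet_Iic]
  congr 1
  ext t
  simp only [mem_inter_iff, mem_Iic, mem_Icc]
  constructor
  · rintro ⟨h1, h2, -⟩
    exact ⟨h2, by linarith⟩
  · rintro ⟨h1, h2⟩
    exact ⟨by linarith, h1, by linarith⟩

theorem unitTime_restrict_Ioi (hl : 0 < l) :
    unitTime.restrict (Iic l)ᶜ = volume.restrict (Icc l (l + (1 - l))) := by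
  rw [compl_Iic, unitTime, Measure.restrict_restrict measurableSet_Ioi, add_sub_cancel,
    ← Measure.restrict_congr_set Ioc_ae_eq_Icc]
  congr 1
  ext t
  simp only [mem_inter_iff, mem_Ioi, mem_Icc, mem_Ioc]
  constructor
  · rintro ⟨h1, -, h2⟩
    exact ⟨h1, h2⟩
  · rintro ⟨h1, h2⟩
    exact ⟨h1, by linarith, h2⟩

theorem lintegral_concat (hl : 0 < l) (hl1 : l < 1) (f g : ℝ → ℝ≥0∞) :
    ∫⁻ t, concat l f g t ∂unitTime =
      ENNReal.ofReal l * ∫⁻ t, f t ∂unitTime + ENNReal.ofReal (1 - l) * ∫⁻ t, g t ∂unitTime := by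
  rw [← lintegral_add_compl _ (measurableSet_Iic (a := l)),
    setLIntegral_congr_fun (g := fun t => f ((t - 0) / l)) measurableSet_Iic
      (fun t ht => by simp only [sub_zero, concat_of_le f g ht]),
    setLIntegral_congr_fun (g := fun t => g ((t - l) / (1 - l))) measurableSet_Iic.compl
      (fun t ht => concat_of_lt f g (not_le.1 ht)),
    unitTime_restrict_Iic hl1, unitTime_restrict_Ioi hl, lintegral_restrict_sub_div hl,
    lintegral_restrict_sub_div (sub_pos.2 hl1)]

theorem aestronglyMeasurable_concat {G : Type*} [TopologicalSpace G] (hl : 0 < l)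
    (hl1 : l < 1) {f g : ℝ → G}
    (hf : AEStronglyMeasurable f unitTime) (hg : AEStronglyMeasurable g unitTime) :
    AEStronglyMeasurable (concat l f g) unitTime := by
  classical
  refine AEStronglyMeasurable.piecewise (s := Iic l) (f := fun t => f (t / l))
    (g := fun t => g ((t - l) / (1 - l))) measurableSet_Iic ?_ ?_
  · rw [unitTime_restrict_Iic hl1]
    have h := hf.comp_quasiMeasurePreserving (quasiMeasurePreserving_sub_div hl 0)
    simp only [sub_zero] at h
    exact h
  · rw [unitTime_restrict_Ioi hl]
    exact hg.comp_quasiMeasurePreserving (quasiMeasurePreserving_sub_div (sub_pos.2 hl1) l)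

theorem aestronglyMeasurable_uncurry_concat {X G : Type*} [MeasurableSpace X] {m : Measure X}
    [SFinite m] [TopologicalSpace G] (hl : 0 < l) (hl1 : l < 1) {f g : ℝ → X → G}
    (hf : AEStronglyMeasurable (Function.uncurry f) (unitTime.prod m))
    (hg : AEStronglyMeasurable (Function.uncurry g) (unitTime.prod m)) :
    AEStronglyMeasurable (Function.uncurry (concat l f g)) (unitTime.prod m) := by
  classical
  have hpiecewise : Function.uncurry (concat l f g) = (Iic l ×ˢ (univ : Set X)).piecewise
      (fun p => f ((p.1 - 0) / l) p.2) (fun p => g ((p.1 - l) / (1 - l)) p.2) := by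
    ext p
    by_cases hp : p.1 ≤ l
    · rw [piecewise_eq_of_mem _ _ _ (show p ∈ Iic l ×ˢ (univ : Set X) from ⟨hp, mem_univ _⟩),
        Function.uncurry, concat_of_le f g hp, sub_zero]
    · rw [piecewise_eq_of_notMem _ _ _ (fun h : p ∈ Iic l ×ˢ (univ : Set X) => hp h.1),
        Function.uncurry, concat_of_lt f g (not_le.1 hp)]
  have hcompl : (Iic l ×ˢ (univ : Set X))ᶜ = (Iic l)ᶜ ×ˢ univ := by ext; simp
  rw [hpiecewise]
  refine AEStronglyMeasurable.piecewise (measurableSet_Iic.prod MeasurableSet.univ) ?_ ?_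
  · rw [← Measure.prod_restrict, Measure.restrict_univ, unitTime_restrict_Iic hl1]
    exact hf.comp_quasiMeasurePreserving
      (QuasiMeasurePreserving.prodMap (quasiMeasurePreserving_sub_div hl 0)
        (Measure.QuasiMeasurePreserving.id m))
  · rw [hcompl, ← Measure.prod_restrict, Measure.restrict_univ, unitTime_restrict_Ioi hl]
    exact hg.comp_quasiMeasurePreserving (QuasiMeasurePreserving.prodMap
      (quasiMeasurePreserving_sub_div (sub_pos.2 hl1) l) (Measure.QuasiMeasurePreserving.id m))

theorem IsPrimitiveOn.concat {G : Type*} [NormedAddCommGroup G] [NormedSpace ℝ G]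
    {w w' f f' : ℝ → G} (hl : 0 < l) (hl1 : l < 1) (hw : IsPrimitiveOn w f 0 1)
    (hw' : IsPrimitiveOn w' f' 0 1) (h : w 1 = w' 0) :
    IsPrimitiveOn (concat l w w') (concat l (fun t => l⁻¹ • f t) fun t => (1 - l)⁻¹ • f' t)
      0 1 := by
  have hleft := hw.comp_sub_div hl 0
  have hright := hw'.comp_sub_div (sub_pos.2 hl1) l
  simp only [sub_zero, add_zero, mul_zero, mul_one, zero_add, sub_add_cancel] at hleft hright
  exact (hleft.congr (fun t ht => (concat_of_le _ _ ht.2).symm)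
    fun t ht => (concat_of_le (fun t => l⁻¹ • f t) (fun t => (1 - l)⁻¹ • f' t) ht.2).symm).trans
      (hright.congr (fun t ht => (concat_of_ge hl h ht.1).symm) fun t ht =>
        (concat_of_lt (fun t => l⁻¹ • f t) (fun t => (1 - l)⁻¹ • f' t) ht.1).symm)

theorem div_mem_Icc (hl : 0 < l) {t : ℝ} (ht : 0 ≤ t) (htl : t ≤ l) : t / l ∈ Icc (0 : ℝ) 1 :=
  ⟨div_nonneg ht hl.le, (div_le_one hl).2 htl⟩

theorem sub_div_mem_Icc (hl1 : l < 1) {t : ℝ} (hlt : l ≤ t) (ht : t ≤ 1) :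
    (t - l) / (1 - l) ∈ Icc (0 : ℝ) 1 :=
  ⟨div_nonneg (sub_nonneg.2 hlt) (sub_pos.2 hl1).le,
    (div_le_one (sub_pos.2 hl1)).2 (by linarith)⟩

theorem forall_concat {G : Type*} {P : G → Prop} {f g : ℝ → G} (hl : 0 < l) (hl1 : l < 1)
    (hf : ∀ t ∈ Icc (0 : ℝ) 1, P (f t)) (hg : ∀ t ∈ Icc (0 : ℝ) 1, P (g t)) :
    ∀ t ∈ Icc (0 : ℝ) 1, P (concat l f g t) := by
  intro t ht
  rcases le_or_gt t l with htl | htl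
  · rw [concat_of_le _ _ htl]
    exact hf _ (div_mem_Icc hl ht.1 htl)
  · rw [concat_of_lt _ _ htl]
    exact hg _ (sub_div_mem_Icc hl1 htl.le ht.2)

theorem concat_one {G : Type*} (hl1 : l < 1) (f g : ℝ → G) : concat l f g 1 = g 1 := by
  rw [concat_of_lt _ _ hl1, div_self (sub_pos.2 hl1).ne']

end TimeChange

/-! ### Square integrable functions -/

section LpTwo

variable {α G : Type*} [MeasurableSpace α] [NormedAddCommGroup G] {m : Measure α} {f : α → G}

theorem eLpNorm_two_eq :
    eLpNorm f 2 m = (∫⁻ x, ENNReal.ofReal (‖f x‖ ^ 2) ∂m) ^ (1 / 2 : ℝ) := by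
  have hsq : ∀ x, ‖f x‖ₑ ^ (2 : ℝ) = ENNReal.ofReal (‖f x‖ ^ 2) := fun x => by
    rw [ENNReal.rpow_ofNat, ENNReal.ofReal_pow (norm_nonneg _), ofReal_norm]
  rw [eLpNorm_eq_lintegral_rpow_enorm_toReal two_ne_zero ENNReal.ofNat_ne_top,
    ENNReal.toReal_ofNat]
  simp only [hsq]

theorem memLp_two_iff_lintegral_sq (hf : AEStronglyMeasurable f m) :
    MemLp f 2 m ↔ ∫⁻ x, ENNReal.ofReal (‖f x‖ ^ 2) ∂m < ⊤ := by
  rw [MemLp, and_iff_right hf, eLpNorm_two_eq, ENNReal.rpow_lt_top_iff_of_pos (by norm_num)]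

theorem lintegral_sq_uncurry {β : Type*} [MeasurableSpace β] {m' : Measure β} [SFinite m']
    {η : α → β → ℝ} (hη : AEStronglyMeasurable (Function.uncurry η) (m.prod m')) :
    ∫⁻ z, ENNReal.ofReal (‖Function.uncurry η z‖ ^ 2) ∂m.prod m' =
      ∫⁻ t, ∫⁻ x, ENNReal.ofReal (η t x ^ 2) ∂m' ∂m := by
  rw [lintegral_prod _ (hη.norm.aemeasurable.pow_const 2).ennreal_ofReal]
  simp [Function.uncurry]

theorem lintegral_lintegral_le_mul {β : Type*} [MeasurableSpace β] {κ κ' : α → Measure β}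
    {C : ℝ≥0∞} (hC : C ≠ ⊤) (h : ∀ᵐ t ∂m, κ t ≤ C • κ' t) (g : α → β → ℝ≥0∞) :
    ∫⁻ t, ∫⁻ x, g t x ∂κ t ∂m ≤ C * ∫⁻ t, ∫⁻ x, g t x ∂κ' t ∂m := by
  rw [← lintegral_const_mul' _ _ hC]
  refine lintegral_mono_ae (h.mono fun t ht => ?_)
  refine (lintegral_mono' ht le_rfl).trans_eq ?_
  rw [lintegral_smul_measure, smul_eq_mul]

variable [NormedSpace ℝ G]

theorem ofReal_sq_norm_integral_le [IsProbabilityMeasure m] (hf : AEStronglyMeasurable f m) :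
    ENNReal.ofReal (‖∫ x, f x ∂m‖ ^ 2) ≤ ∫⁻ x, ENNReal.ofReal (‖f x‖ ^ 2) ∂m := by
  have hL2 : ‖∫ x, f x ∂m‖ₑ ≤ (∫⁻ x, ENNReal.ofReal (‖f x‖ ^ 2) ∂m) ^ (1 / 2 : ℝ) :=
    calc ‖∫ x, f x ∂m‖ₑ ≤ ∫⁻ x, ‖f x‖ₑ ∂m := enorm_integral_le_lintegral_enorm f
      _ = eLpNorm f 1 m := eLpNorm_one_eq_lintegral_enorm.symm
      _ ≤ eLpNorm f 2 m := eLpNorm_le_eLpNorm_of_exponent_le one_le_two hf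
      _ = _ := eLpNorm_two_eq
  rw [ENNReal.ofReal_pow (norm_nonneg _), ofReal_norm]
  calc ‖∫ x, f x ∂m‖ₑ ^ 2 ≤ ((∫⁻ x, ENNReal.ofReal (‖f x‖ ^ 2) ∂m) ^ (1 / 2 : ℝ)) ^ 2 := by gcongr
    _ = _ := by rw [← ENNReal.rpow_ofNat, ← ENNReal.rpow_mul]; norm_num

theorem lintegral_sq_norm_inv_smul (f : α → G) {r : ℝ} (hr : 0 < r) :
    ENNReal.ofReal r * ∫⁻ x, ENNReal.ofReal (‖r⁻¹ • f x‖ ^ 2) ∂m =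
      ENNReal.ofReal r⁻¹ * ∫⁻ x, ENNReal.ofReal (‖f x‖ ^ 2) ∂m := by
  rw [← lintegral_const_mul' _ _ ENNReal.ofReal_ne_top,
    ← lintegral_const_mul' _ _ ENNReal.ofReal_ne_top]
  refine lintegral_congr fun t => ?_
  rw [← ENNReal.ofReal_mul hr.le, ← ENNReal.ofReal_mul (inv_pos.2 hr).le, norm_smul,
    Real.norm_of_nonneg (inv_pos.2 hr).le]
  congr 1
  field_simp

end LpTwo

/-! ### Admissible paths -/

section Weight

variable {n d : ℕ} {η : ℝ → E n → ℝ}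

instance (μ : Varifold n d) : IsFiniteMeasure (weight μ.toMeasure) := by
  unfold weight; infer_instance

/-- The Fisher-Rao part `∫₀¹ ∫ η_t² ∘ φ_t⁻¹ d|(φ_t)_# μ| dt` of the energy, pulled back to the
initial varifold. -/
def weightEnergy (μ : Measure (E n × OrientedGrassmannian n d)) (φ : ℝ → E n → E n)
    (η : ℝ → E n → ℝ) : ℝ≥0∞ :=
  ∫⁻ t, ∫⁻ x, ENNReal.ofReal (η t x ^ 2) ∂tilt (φ t) μ ∂unitTime

theorem integral_unitTime {G : Type*} [NormedAddCommGroup G] [NormedSpace ℝ G] (f : ℝ → G) :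
    ∫ s in (0 : ℝ)..1, f s = ∫ s, f s ∂unitTime := by
  rw [intervalIntegral.integral_of_le zero_le_one, unitTime, integral_Icc_eq_integral_Ioc]

theorem sqrtWeight_zero (x : E n) : sqrtWeight η 0 x = 1 := by simp [sqrtWeight]

theorem aemeasurable_sqrtWeight_one {m : Measure (E n)} [SFinite m]
    (hη : AEStronglyMeasurable (Function.uncurry η) (unitTime.prod m)) :
    AEMeasurable (sqrtWeight η 1) m := by
  have h := (hη.prod_swap.integral_prod_right' (μ := m) (ν := unitTime)).aemeasurable
  refine ((h.const_mul (1 / 2)).const_add 1).congr (Eventually.of_forall fun x => ?_)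
  simp only [sqrtWeight, integral_unitTime]
  rfl

theorem isPrimitiveOn_sqrtWeight {x : E n} (hη : Integrable (fun s => η s x) unitTime) :
    IsPrimitiveOn (fun t => sqrtWeight η t x) (fun s => (1 / 2 : ℝ) * η s x) 0 1 where
  le := zero_le_one
  intervalIntegrable := intervalIntegrable_iff_integrable_unitTime.2 (hη.const_mul _)
  apply_eq t _ := by
    rw [sqrtWeight_zero, sqrtWeight, intervalIntegral.integral_const_mul]

theorem IsPrimitiveOn.sqrtWeight_eq {w : ℝ → ℝ} {x : E n}
    (h : IsPrimitiveOn w (fun s => (1 / 2 : ℝ) * η s x) 0 1) (h0 : w 0 = 1) {t : ℝ}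
    (ht : t ∈ Icc (0 : ℝ) 1) : sqrtWeight η t x = w t := by
  rw [sqrtWeight, ← intervalIntegral.integral_const_mul, h.apply_eq t ht, h0]

theorem tilt_rescale {φ : E n → E n} (hφ : IsDiffeo φ)
    {μ : Measure (E n × OrientedGrassmannian n d)} {a : E n → ℝ}
    (ha : AEMeasurable a (weight μ)) :
    tilt φ (rescale a μ) = (tilt φ μ).withDensity fun x => ENNReal.ofReal (a x) := by
  have ha' : AEMeasurable (fun p : E n × OrientedGrassmannian n d => ENNReal.ofReal (a p.1)) μ :=
    (ha.comp_measurable measurable_fst).ennreal_ofReal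
  have hJ : AEMeasurable (pushDensity φ) μ := hφ.measurable_pushDensity.aemeasurable
  rw [tilt, rescale, ← withDensity_mul₀ ha' hJ, mul_comm, withDensity_mul₀ hJ ha']
  exact weight_rescale (ha.mono_ac tilt_absolutelyContinuous)

end Weight

theorem IsDiffeo.measurable_invFun {n : ℕ} {f : E n → E n} (hf : IsDiffeo f) :
    Measurable (Function.invFun f) := by
  have hsymm : Function.invFun f = hf.isHomeomorph.homeomorph.symm := by
    ext1 y
    obtain ⟨x, rfl⟩ := hf.isHomeomorph.surjective y
    rw [hf.invFun_apply]
    exact (hf.isHomeomorph.homeomorph.symm_apply_apply x).symm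
  rw [hsymm]
  exact hf.isHomeomorph.homeomorph.symm.continuous.measurable

theorem quasiMeasurePreserving_of_forall_ae {α β : Type*} [MeasurableSpace α] [MeasurableSpace β]
    {m : Measure α} {m' : Measure β} {f : α → β} (hf : Measurable f)
    (h : ∀ P : β → Prop, (∀ᵐ y ∂m', P y) → ∀ᵐ x ∂m, P (f x)) :
    Measure.QuasiMeasurePreserving f m m' := by
  refine ⟨hf, Measure.AbsolutelyContinuous.mk fun s hs h0 => ?_⟩
  rw [Measure.map_apply hf hs]
  exact measure_eq_zero_iff_ae_notMem.2 (h (· ∉ s) (measure_eq_zero_iff_ae_notMem.1 h0))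

section Admissible

variable {n d : ℕ} {V : Type*} [NormedAddCommGroup V] [InnerProductSpace ℝ V]
  {F : FieldSpace n V} {μ ν : Varifold n d} {v : ℝ → V} {φ : ℝ → E n → E n} {η : ℝ → E n → ℝ}

namespace IsFlow

theorem energy_eq (hφ : IsFlow F v φ) (hv : Integrable v unitTime) (γ : ℝ) :
    energy γ μ v φ η = ENNReal.ofReal (1 / 2) * (∫⁻ t, ENNReal.ofReal (‖v t‖ ^ 2) ∂unitTime) +
      ENNReal.ofReal (γ / 2) * weightEnergy μ.toMeasure φ η := by
  rw [energy, weightEnergy]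
  congr 2
  refine lintegral_congr_ae ?_
  filter_upwards [ae_unitTime_mem] with t ht
  exact (hφ.isDiffeo hv ht).lintegral_weight_pushforward fun x => ENNReal.ofReal (η t x ^ 2)

theorem tilt_le (hφ : IsFlow F v φ) (hv : Integrable v unitTime) {t : ℝ}
    (ht : t ∈ Icc (0 : ℝ) 1) (μ : Measure (E n × OrientedGrassmannian n d)) :
    tilt (φ t) μ ≤ ENNReal.ofReal (jacobianBound d (Real.exp (flowConst F v))) • weight μ :=
  LddmmFR.tilt_le fun _ => jacobian_le (hφ.norm_fderiv_apply_le hv ht _) _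

theorem weight_le (hφ : IsFlow F v φ) (hv : Integrable v unitTime) {t : ℝ}
    (ht : t ∈ Icc (0 : ℝ) 1) (μ : Measure (E n × OrientedGrassmannian n d)) :
    weight μ ≤ ENNReal.ofReal (jacobianBound d (Real.exp (flowConst F v))) • tilt (φ t) μ :=
  weight_le_smul_tilt (fun _ => one_le_jacobianBound_mul (hφ.norm_le_norm_fderiv_apply hv ht _) _)
    (Real.sqrt_nonneg _)

theorem weightEnergy_le (hφ : IsFlow F v φ) (hv : Integrable v unitTime) :
    weightEnergy μ.toMeasure φ η ≤ ENNReal.ofReal (jacobianBound d (Real.exp (flowConst F v))) *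
      ∫⁻ t, ∫⁻ x, ENNReal.ofReal (η t x ^ 2) ∂weight μ.toMeasure ∂unitTime :=
  lintegral_lintegral_le_mul ENNReal.ofReal_ne_top
    (ae_unitTime_mem.mono fun _ ht => hφ.tilt_le hv ht μ.toMeasure) _

theorem le_weightEnergy (hφ : IsFlow F v φ) (hv : Integrable v unitTime) :
    ∫⁻ t, ∫⁻ x, ENNReal.ofReal (η t x ^ 2) ∂weight μ.toMeasure ∂unitTime ≤
      ENNReal.ofReal (jacobianBound d (Real.exp (flowConst F v))) *
        weightEnergy μ.toMeasure φ η :=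
  lintegral_lintegral_le_mul ENNReal.ofReal_ne_top
    (ae_unitTime_mem.mono fun _ ht => hφ.weight_le hv ht μ.toMeasure) _

theorem memLp_weight_iff (hφ : IsFlow F v φ) (hv : Integrable v unitTime)
    (hη : AEStronglyMeasurable (Function.uncurry η) (unitTime.prod (weight μ.toMeasure))) :
    MemLp (Function.uncurry η) 2 (unitTime.prod (weight μ.toMeasure)) ↔
      weightEnergy μ.toMeasure φ η < ⊤ := by
  rw [memLp_two_iff_lintegral_sq hη, lintegral_sq_uncurry hη]
  exact ⟨fun h => (hφ.weightEnergy_le hv).trans_lt (ENNReal.mul_lt_top ENNReal.ofReal_lt_top h),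
    fun h => (hφ.le_weightEnergy hv).trans_lt (ENNReal.mul_lt_top ENNReal.ofReal_lt_top h)⟩

end IsFlow

namespace Admissible

theorem integrable_field (h : Admissible F μ v φ η) : Integrable v unitTime :=
  h.memLp_field.integrable one_le_two

theorem isDiffeo (h : Admissible F μ v φ η) {t : ℝ} (ht : t ∈ Icc (0 : ℝ) 1) : IsDiffeo (φ t) :=
  h.isFlow.isDiffeo h.integrable_field ht

theorem isDiffeo_one (h : Admissible F μ v φ η) : IsDiffeo (φ 1) := h.isDiffeo (by simp)

theorem weightEnergy_lt_top (h : Admissible F μ v φ η) : weightEnergy μ.toMeasure φ η < ⊤ :=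
  (h.isFlow.memLp_weight_iff h.integrable_field h.memLp_weight.1).1 h.memLp_weight

theorem energy_ne_top (h : Admissible F μ v φ η) (γ : ℝ) : energy γ μ v φ η ≠ ⊤ := by
  rw [h.isFlow.energy_eq h.integrable_field]
  exact ENNReal.add_ne_top.2 ⟨ENNReal.mul_ne_top ENNReal.ofReal_ne_top
      ((memLp_two_iff_lintegral_sq h.memLp_field.1).1 h.memLp_field).ne,
    ENNReal.mul_ne_top ENNReal.ofReal_ne_top h.weightEnergy_lt_top.ne⟩

theorem ae_integrable (h : Admissible F μ v φ η) :
    ∀ᵐ x ∂weight μ.toMeasure, Integrable (fun s => η s x) unitTime :=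
  (h.memLp_weight.integrable one_le_two).prod_left_ae

theorem aemeasurable_sqrtWeight (h : Admissible F μ v φ η) :
    AEMeasurable (sqrtWeight η 1) (weight μ.toMeasure) :=
  aemeasurable_sqrtWeight_one h.memLp_weight.1

theorem transformed_eq (h : Admissible F μ v φ η) :
    transformed μ φ η 1 =
      pushforward (φ 1) (rescale (fun x => sqrtWeight η 1 x ^ 2) μ.toMeasure) :=
  (h.isDiffeo_one.pushforward_rescale (h.aemeasurable_sqrtWeight.pow_const 2)).symm

theorem ae_pos (h : Admissible F μ v φ η) : ∀ᵐ x ∂weight μ.toMeasure, 0 < sqrtWeight η 1 x :=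
  h.pos.mono fun _ hx => hx 1 (by simp)

theorem ae_weight_iff (h : Admissible F μ v φ η) (hν : ν.toMeasure = transformed μ φ η 1)
    {P : E n → Prop} :
    (∀ᵐ y ∂weight ν.toMeasure, P y) ↔ ∀ᵐ x ∂weight μ.toMeasure, P (φ 1 x) := by
  rw [hν, h.transformed_eq, h.isDiffeo_one.ae_weight_pushforward_iff,
    ae_weight_rescale_iff (h.aemeasurable_sqrtWeight.pow_const 2)]
  exact h.ae_pos.mono fun x hx => by positivity

theorem quasiMeasurePreserving (h : Admissible F μ v φ η)
    (hν : ν.toMeasure = transformed μ φ η 1) :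
    Measure.QuasiMeasurePreserving (φ 1) (weight μ.toMeasure) (weight ν.toMeasure) :=
  quasiMeasurePreserving_of_forall_ae h.isDiffeo_one.measurableEmbedding.measurable
    fun _ => (h.ae_weight_iff hν).1

theorem quasiMeasurePreserving_invFun (h : Admissible F μ v φ η)
    (hν : ν.toMeasure = transformed μ φ η 1) :
    Measure.QuasiMeasurePreserving (Function.invFun (φ 1)) (weight ν.toMeasure)
      (weight μ.toMeasure) :=
  quasiMeasurePreserving_of_forall_ae h.isDiffeo_one.measurable_invFun fun P hP =>
    (h.ae_weight_iff hν).2 (by simpa only [h.isDiffeo_one.invFun_apply] using hP)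

theorem lintegral_tilt (h : Admissible F μ v φ η) (hν : ν.toMeasure = transformed μ φ η 1)
    {ψ : E n → E n} (hψ : IsDiffeo ψ) (f : E n → ℝ≥0∞) :
    ∫⁻ y, f y ∂tilt ψ ν.toMeasure =
      ∫⁻ x, ENNReal.ofReal (sqrtWeight η 1 x ^ 2) * f (φ 1 x) ∂tilt (ψ ∘ φ 1) μ.toMeasure := by
  have hφ := h.isDiffeo_one
  have ha := h.aemeasurable_sqrtWeight.pow_const 2
  have hcomp (y : E n) : f (Function.invFun ψ y) =
      (fun x => f (φ 1 x)) (Function.invFun (ψ ∘ φ 1) y) := by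
    simp only [hψ.invFun_comp hφ, hφ.apply_invFun]
  rw [← hψ.lintegral_weight_pushforward, hν, h.transformed_eq, ← hψ.pushforward_comp hφ]
  simp only [hcomp]
  rw [(hψ.comp hφ).lintegral_weight_pushforward fun x => f (φ 1 x), tilt_rescale (hψ.comp hφ) ha,
    lintegral_withDensity_eq_lintegral_mul_non_measurable₀ _
      (ha.mono_ac tilt_absolutelyContinuous).ennreal_ofReal
      (Eventually.of_forall fun _ => ENNReal.ofReal_lt_top)]
  rfl

theorem rescale_pushforward (h : Admissible F μ v φ η) (hν : ν.toMeasure = transformed μ φ η 1)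
    {ψ : E n → E n} (hψ : IsDiffeo ψ) {β : E n → ℝ} (hβ : AEMeasurable β (weight ν.toMeasure))
    {b : E n → ℝ} (hb : ∀ᵐ x ∂weight μ.toMeasure, b x = sqrtWeight η 1 x * β (φ 1 x)) :
    rescale (fun y => β (Function.invFun ψ y) ^ 2) (pushforward ψ ν.toMeasure) =
      rescale (fun y => b (Function.invFun (ψ ∘ φ 1) y) ^ 2)
        (pushforward (ψ ∘ φ 1) μ.toMeasure) := by
  have hφ := h.isDiffeo_one
  have ha := h.aemeasurable_sqrtWeight.pow_const 2
  have hβφ : AEMeasurable (fun x => β (φ 1 x)) (weight μ.toMeasure) :=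
    hβ.comp_quasiMeasurePreserving (h.quasiMeasurePreserving hν)
  have hbm : AEMeasurable b (weight μ.toMeasure) :=
    (h.aemeasurable_sqrtWeight.mul hβφ).congr (hb.mono fun x hx => hx.symm)
  have hpull : (fun y => β y ^ 2) =
      fun y => (fun x => β (φ 1 x) ^ 2) (Function.invFun (φ 1) y) := by
    simp only [hφ.apply_invFun]
  rw [← hψ.pushforward_rescale (a := fun y => β y ^ 2) (hβ.pow_const 2),
    ← (hψ.comp hφ).pushforward_rescale (a := fun y => b y ^ 2) (hbm.pow_const 2),
    hψ.pushforward_comp hφ, hpull, hν, h.transformed_eq, ← hφ.pushforward_rescale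
      ((hβφ.pow_const 2).mono_ac weight_rescale_absolutelyContinuous),
    rescale_rescale ha (hβφ.pow_const 2) fun x => sq_nonneg _]
  congr 2
  refine rescale_congr (hb.mono fun x hx => ?_)
  simp only [hx, mul_pow]

end Admissible

end Admissible

/-! ### Reversal and concatenation of paths -/

section ReverseField

variable {V : Type*} [NormedAddCommGroup V] {v : ℝ → V}

/-- The control of the time-reversed flow. -/
def reverseField (v : ℝ → V) (t : ℝ) : V := -v (1 - t)

theorem memLp_reverseField (hv : MemLp v 2 unitTime) : MemLp (reverseField v) 2 unitTime :=
  (hv.comp_measurePreserving measurePreserving_one_sub).neg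

theorem lintegral_reverseField (v : ℝ → V) :
    ∫⁻ t, ENNReal.ofReal (‖reverseField v t‖ ^ 2) ∂unitTime =
      ∫⁻ t, ENNReal.ofReal (‖v t‖ ^ 2) ∂unitTime := by
  simp only [reverseField, norm_neg]
  exact measurePreserving_one_sub.lintegral_comp_emb measurableEmbedding_one_sub
    fun t => ENNReal.ofReal (‖v t‖ ^ 2)

end ReverseField

section Paths

variable {n d : ℕ} {V : Type*} [NormedAddCommGroup V] [InnerProductSpace ℝ V]
  {F : FieldSpace n V} {γ : ℝ} {μ ν ρ : Varifold n d} {v v' : ℝ → V} {φ φ' : ℝ → E n → E n}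
  {η η' : ℝ → E n → ℝ}

/-- There is an admissible path of energy `c` from `μ` to `ν`. -/
def Joins (F : FieldSpace n V) (γ : ℝ) (μ ν : Varifold n d) (c : ℝ≥0∞) : Prop :=
  ∃ v φ η, Admissible F μ v φ η ∧ ν.toMeasure = transformed μ φ η 1 ∧ c = energy γ μ v φ η

theorem Joins.refl (F : FieldSpace n V) (γ : ℝ) (μ : Varifold n d) : Joins F γ μ μ 0 := by
  refine ⟨0, fun _ => id, 0, ⟨MemLp.zero, fun x => ⟨continuousOn_const, fun t _ => by simp⟩,
    MemLp.zero, ?_⟩, ?_, ?_⟩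
  · simp [sqrtWeight]
  · simp [transformed, pushforward_id, rescale, sqrtWeight]
  · simp [energy]

/-- A weight control `η'` given at the end of the path `(φ, η)`, pulled back to its start. The
factor `√α_1` accounts for the mass change along `(φ, η)`. -/
def pullbackWeight (φ : ℝ → E n → E n) (η η' : ℝ → E n → ℝ) (t : ℝ) (x : E n) : ℝ :=
  sqrtWeight η 1 x * η' t (φ 1 x)

theorem Admissible.weightEnergy_pullback (h : Admissible F μ v φ η)
    (hν : ν.toMeasure = transformed μ φ η 1) {ψ : ℝ → E n → E n}
    (hψ : ∀ t ∈ Icc (0 : ℝ) 1, IsDiffeo (ψ t)) :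
    weightEnergy μ.toMeasure (fun t => ψ t ∘ φ 1) (pullbackWeight φ η η') =
      weightEnergy ν.toMeasure ψ η' := by
  refine lintegral_congr_ae (ae_unitTime_mem.mono fun t ht => ?_)
  simp only [pullbackWeight, mul_pow, ENNReal.ofReal_mul (sq_nonneg _)]
  exact (h.lintegral_tilt hν (hψ t ht) fun y => ENNReal.ofReal (η' t y ^ 2)).symm

/-- The time-reversed flow. -/
def reverseFlow (φ : ℝ → E n → E n) (t : ℝ) (y : E n) : E n := φ (1 - t) (Function.invFun (φ 1) y)

/-- The weight control of the time-reversed path. -/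
def reverseWeight (φ : ℝ → E n → E n) (η : ℝ → E n → ℝ) (t : ℝ) (y : E n) : ℝ :=
  -(η (1 - t) (Function.invFun (φ 1) y) / sqrtWeight η 1 (Function.invFun (φ 1) y))

theorem one_sub_mem_Icc {t : ℝ} (ht : t ∈ Icc (0 : ℝ) 1) : 1 - t ∈ Icc (0 : ℝ) 1 :=
  ⟨by linarith [ht.2], by linarith [ht.1]⟩

theorem IsDiffeo.reverseFlow_comp (h : IsDiffeo (φ 1)) (t : ℝ) :
    reverseFlow φ t ∘ φ 1 = φ (1 - t) := by
  ext1 x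
  rw [Function.comp_apply, reverseFlow, h.invFun_apply]

theorem IsDiffeo.reverseWeight_apply (h : IsDiffeo (φ 1)) (t : ℝ) (x : E n) :
    reverseWeight φ η t (φ 1 x) = -(η (1 - t) x / sqrtWeight η 1 x) := by
  rw [reverseWeight, h.invFun_apply]

theorem IsFlow.reverse (hφ : IsFlow F v φ) (hv : Integrable v unitTime) :
    IsFlow F (reverseField v) (reverseFlow φ) := by
  refine .of_isPrimitiveOn (fun y => ?_) fun y => ?_
  · rw [reverseFlow, sub_zero, (hφ.isDiffeo hv (by simp)).apply_invFun]
  · simpa only [reverseField, reverseFlow, map_neg, Pi.neg_apply, sub_self, sub_zero] using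
      (hφ.isPrimitiveOn hv (Function.invFun (φ 1) y)).comp_sub_left 1

namespace Admissible

theorem sqrtWeight_reverse (h : Admissible F μ v φ η) :
    ∀ᵐ x ∂weight μ.toMeasure, ∀ t ∈ Icc (0 : ℝ) 1,
      sqrtWeight (reverseWeight φ η) t (φ 1 x) = (sqrtWeight η 1 x)⁻¹ * sqrtWeight η (1 - t) x := by
  filter_upwards [h.ae_pos, h.ae_integrable] with x hx hi t ht
  have hprim := ((isPrimitiveOn_sqrtWeight hi).comp_sub_left 1).const_smul (sqrtWeight η 1 x)⁻¹
  simp only [sub_self, sub_zero, smul_eq_mul] at hprim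
  refine (hprim.congr (fun _ _ => rfl) fun s _ => ?_).sqrtWeight_eq ?_ ht
  · rw [h.isDiffeo_one.reverseWeight_apply]
    ring
  · rw [sub_zero, inv_mul_cancel₀ hx.ne']

theorem aestronglyMeasurable_reverseWeight (h : Admissible F μ v φ η)
    (hν : ν.toMeasure = transformed μ φ η 1) :
    AEStronglyMeasurable (Function.uncurry (reverseWeight φ η))
      (unitTime.prod (weight ν.toMeasure)) := by
  have hq := h.quasiMeasurePreserving_invFun hν
  have hη : AEStronglyMeasurable (fun p : ℝ × E n => η (1 - p.1) (Function.invFun (φ 1) p.2))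
      (unitTime.prod (weight ν.toMeasure)) :=
    h.memLp_weight.1.comp_quasiMeasurePreserving
      (QuasiMeasurePreserving.prodMap measurePreserving_one_sub.quasiMeasurePreserving hq)
  have hα : AEMeasurable (fun p : ℝ × E n => sqrtWeight η 1 (Function.invFun (φ 1) p.2))
      (unitTime.prod (weight ν.toMeasure)) :=
    (h.aemeasurable_sqrtWeight.comp_quasiMeasurePreserving hq).comp_snd
  exact (hη.aemeasurable.div hα).neg.aestronglyMeasurable

theorem isFlow_reverse (h : Admissible F μ v φ η) : IsFlow F (reverseField v) (reverseFlow φ) :=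
  h.isFlow.reverse h.integrable_field

theorem integrable_reverseField (h : Admissible F μ v φ η) :
    Integrable (reverseField v) unitTime :=
  (memLp_reverseField h.memLp_field).integrable one_le_two

theorem weightEnergy_reverse (h : Admissible F μ v φ η) (hν : ν.toMeasure = transformed μ φ η 1) :
    weightEnergy ν.toMeasure (reverseFlow φ) (reverseWeight φ η) =
      weightEnergy μ.toMeasure φ η := by
  rw [← h.weightEnergy_pullback hν fun t => h.isFlow_reverse.isDiffeo h.integrable_reverseField,
    weightEnergy, weightEnergy,
    ← measurePreserving_one_sub.lintegral_comp_emb measurableEmbedding_one_sub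
      fun t => ∫⁻ x, ENNReal.ofReal (η t x ^ 2) ∂tilt (φ t) μ.toMeasure]
  refine lintegral_congr fun t => ?_
  rw [h.isDiffeo_one.reverseFlow_comp]
  refine lintegral_congr_ae ?_
  filter_upwards [tilt_absolutelyContinuous.ae_le h.ae_pos] with x hx
  rw [pullbackWeight, h.isDiffeo_one.reverseWeight_apply, mul_neg, mul_div_cancel₀ _ hx.ne', neg_sq]

theorem reverse (h : Admissible F μ v φ η) (hν : ν.toMeasure = transformed μ φ η 1) :
    Admissible F ν (reverseField v) (reverseFlow φ) (reverseWeight φ η) where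
  memLp_field := memLp_reverseField h.memLp_field
  isFlow := h.isFlow_reverse
  memLp_weight := by
    rw [h.isFlow_reverse.memLp_weight_iff h.integrable_reverseField
      (h.aestronglyMeasurable_reverseWeight hν), h.weightEnergy_reverse hν]
    exact h.weightEnergy_lt_top
  pos := by
    refine (h.ae_weight_iff hν).2 ?_
    filter_upwards [h.pos, h.sqrtWeight_reverse] with x hx hrev t ht
    rw [hrev t ht]
    exact mul_pos (inv_pos.2 (hx 1 (by simp))) (hx _ (one_sub_mem_Icc ht))

theorem transformed_reverse (h : Admissible F μ v φ η) (hν : ν.toMeasure = transformed μ φ η 1) :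
    transformed ν (reverseFlow φ) (reverseWeight φ η) 1 = μ.toMeasure := by
  have hadm := h.reverse hν
  have hcomp : reverseFlow φ 1 ∘ φ 1 = id := by
    rw [h.isDiffeo_one.reverseFlow_comp, sub_self]
    exact funext h.isFlow.apply_zero
  rw [transformed, h.rescale_pushforward hν hadm.isDiffeo_one hadm.aemeasurable_sqrtWeight
    (b := fun _ => 1), hcomp, pushforward_id]
  · simp [rescale]
  · filter_upwards [h.sqrtWeight_reverse, h.ae_pos] with x hrev hx
    rw [hrev 1 (by simp), mul_inv_cancel_left₀ hx.ne', sub_self, sqrtWeight_zero]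

theorem energy_reverse (h : Admissible F μ v φ η) (hν : ν.toMeasure = transformed μ φ η 1) :
    energy γ ν (reverseField v) (reverseFlow φ) (reverseWeight φ η) = energy γ μ v φ η := by
  rw [h.isFlow.energy_eq h.integrable_field, h.isFlow_reverse.energy_eq h.integrable_reverseField,
    h.weightEnergy_reverse hν, lintegral_reverseField]

end Admissible

theorem Joins.symm {c : ℝ≥0∞} (hj : Joins F γ μ ν c) : Joins F γ ν μ c := by
  obtain ⟨v, φ, η, h, hν, rfl⟩ := hj
  exact ⟨_, _, _, h.reverse hν, (h.transformed_reverse hν).symm, (h.energy_reverse hν).symm⟩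

/-- The control of the concatenation of two flows. -/
def concatField (l : ℝ) (v v' : ℝ → V) : ℝ → V :=
  concat l (fun t => l⁻¹ • v t) fun t => (1 - l)⁻¹ • v' t

/-- The concatenation of two flows. -/
def concatFlow (l : ℝ) (φ φ' : ℝ → E n → E n) : ℝ → E n → E n :=
  concat l φ fun t => φ' t ∘ φ 1

/-- The weight control of the concatenation of two paths. -/
def concatWeight (l : ℝ) (φ : ℝ → E n → E n) (η η' : ℝ → E n → ℝ) : ℝ → E n → ℝ :=
  concat l (fun t x => l⁻¹ * η t x) fun t x => (1 - l)⁻¹ * pullbackWeight φ η η' t x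

variable {l : ℝ}

theorem lintegral_concatField (hl : 0 < l) (hl1 : l < 1) :
    ∫⁻ t, ENNReal.ofReal (‖concatField l v v' t‖ ^ 2) ∂unitTime =
      ENNReal.ofReal l⁻¹ * (∫⁻ t, ENNReal.ofReal (‖v t‖ ^ 2) ∂unitTime) +
      ENNReal.ofReal (1 - l)⁻¹ * ∫⁻ t, ENNReal.ofReal (‖v' t‖ ^ 2) ∂unitTime := by
  simp only [concatField, map_concat (fun x : V => ENNReal.ofReal (‖x‖ ^ 2))]
  rw [lintegral_concat hl hl1, lintegral_sq_norm_inv_smul v hl,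
    lintegral_sq_norm_inv_smul v' (sub_pos.2 hl1)]

theorem memLp_concatField (hl : 0 < l) (hl1 : l < 1) (hv : MemLp v 2 unitTime)
    (hv' : MemLp v' 2 unitTime) : MemLp (concatField l v v') 2 unitTime := by
  have hmeas : AEStronglyMeasurable (concatField l v v') unitTime :=
    aestronglyMeasurable_concat hl hl1 (hv.1.const_smul _) (hv'.1.const_smul _)
  rw [memLp_two_iff_lintegral_sq hmeas, lintegral_concatField hl hl1]
  exact ENNReal.add_lt_top.2
    ⟨ENNReal.mul_lt_top ENNReal.ofReal_lt_top ((memLp_two_iff_lintegral_sq hv.1).1 hv),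
      ENNReal.mul_lt_top ENNReal.ofReal_lt_top ((memLp_two_iff_lintegral_sq hv'.1).1 hv')⟩

theorem IsFlow.concat (hl : 0 < l) (hl1 : l < 1) (hφ : IsFlow F v φ) (hφ' : IsFlow F v' φ')
    (hv : Integrable v unitTime) (hv' : Integrable v' unitTime) :
    IsFlow F (concatField l v v') (concatFlow l φ φ') := by
  have hat (t : ℝ) (x : E n) : concatFlow l φ φ' t x =
      LddmmFR.concat l (fun t => φ t x) (fun t => φ' t (φ 1 x)) t :=
    map_concat (fun f : E n → E n => f x) l _ _ t
  have hfield (t : ℝ) (x : E n) : F.field (concatField l v v' t) (concatFlow l φ φ' t x) =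
      LddmmFR.concat l (fun s => l⁻¹ • F.field (v s) (φ s x))
        (fun s => (1 - l)⁻¹ • F.field (v' s) (φ' s (φ 1 x))) t := by
    rw [hat, concatField, map₂_concat (fun u z => F.field u z)]
    simp only [map_smul, Pi.smul_apply]
  refine .of_isPrimitiveOn (fun x => ?_) fun x => ?_
  · rw [hat, concat_of_le _ _ hl.le, zero_div, hφ.apply_zero]
  · simp only [hfield]
    simp only [hat]
    exact (hφ.isPrimitiveOn hv x).concat hl hl1 (hφ'.isPrimitiveOn hv' (φ 1 x))
      (hφ'.apply_zero _).symm

theorem weightEnergy_concat (hl : 0 < l) (hl1 : l < 1)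
    (μ : Measure (E n × OrientedGrassmannian n d)) :
    weightEnergy μ (concat l φ φ') (concat l (fun t x => l⁻¹ * η t x)
        fun t x => (1 - l)⁻¹ * η' t x) =
      ENNReal.ofReal l⁻¹ * weightEnergy μ φ η +
        ENNReal.ofReal (1 - l)⁻¹ * weightEnergy μ φ' η' := by
  have hscale {r : ℝ} (hr : 0 < r) (φ : ℝ → E n → E n) (η : ℝ → E n → ℝ) :
      ENNReal.ofReal r * weightEnergy μ φ (fun t x => r⁻¹ * η t x) =
        ENNReal.ofReal r⁻¹ * weightEnergy μ φ η := by
    have h (t : ℝ) := lintegral_sq_norm_inv_smul (m := tilt (φ t) μ) (η t) hr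
    simp only [smul_eq_mul, Real.norm_eq_abs, sq_abs] at h
    rw [weightEnergy, weightEnergy, ← lintegral_const_mul' _ _ ENNReal.ofReal_ne_top,
      ← lintegral_const_mul' _ _ ENNReal.ofReal_ne_top]
    exact lintegral_congr h
  rw [← hscale hl, ← hscale (sub_pos.2 hl1), weightEnergy, weightEnergy, weightEnergy,
    ← lintegral_concat hl hl1]
  simp only [map₂_concat (fun (g : E n → ℝ) (f : E n → E n) =>
    ∫⁻ x, ENNReal.ofReal (g x ^ 2) ∂tilt f μ)]

namespace Admissible

theorem sqrtWeight_concat (hl : 0 < l) (hl1 : l < 1) (h : Admissible F μ v φ η)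
    (hν : ν.toMeasure = transformed μ φ η 1) (h' : Admissible F ν v' φ' η') :
    ∀ᵐ x ∂weight μ.toMeasure, ∀ t ∈ Icc (0 : ℝ) 1,
      sqrtWeight (concatWeight l φ η η') t x = concat l (fun t => sqrtWeight η t x)
        (fun t => sqrtWeight η 1 x * sqrtWeight η' t (φ 1 x)) t := by
  filter_upwards [h.ae_integrable, (h.ae_weight_iff hν).1 h'.ae_integrable] with x hi hi' t ht
  have hprim := (isPrimitiveOn_sqrtWeight hi).concat hl hl1
    ((isPrimitiveOn_sqrtWeight hi').const_smul (sqrtWeight η 1 x))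
    (by rw [sqrtWeight_zero, smul_eq_mul, mul_one])
  refine (hprim.congr (fun _ _ => rfl) fun s _ => ?_).sqrtWeight_eq ?_ ht
  · rw [concatWeight, map_concat (fun f : E n → ℝ => 1 / 2 * f x)]
    simp only [smul_eq_mul, pullbackWeight, mul_left_comm]
  · rw [concat_of_le _ _ hl.le, zero_div, sqrtWeight_zero]

theorem aestronglyMeasurable_concatWeight (hl : 0 < l) (hl1 : l < 1) (h : Admissible F μ v φ η)
    (hν : ν.toMeasure = transformed μ φ η 1) (h' : Admissible F ν v' φ' η') :
    AEStronglyMeasurable (Function.uncurry (concatWeight l φ η η'))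
      (unitTime.prod (weight μ.toMeasure)) := by
  have hη' : AEStronglyMeasurable (fun p : ℝ × E n => η' p.1 (φ 1 p.2))
      (unitTime.prod (weight μ.toMeasure)) :=
    h'.memLp_weight.1.comp_quasiMeasurePreserving (QuasiMeasurePreserving.prodMap
      (Measure.QuasiMeasurePreserving.id unitTime) (h.quasiMeasurePreserving hν))
  exact aestronglyMeasurable_uncurry_concat hl hl1 (h.memLp_weight.1.const_mul _)
    ((h.aemeasurable_sqrtWeight.comp_snd.mul hη'.aemeasurable).const_mul _).aestronglyMeasurable

theorem weightEnergy_concat (hl : 0 < l) (hl1 : l < 1) (h : Admissible F μ v φ η)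
    (hν : ν.toMeasure = transformed μ φ η 1) (h' : Admissible F ν v' φ' η') :
    weightEnergy μ.toMeasure (concatFlow l φ φ') (concatWeight l φ η η') =
      ENNReal.ofReal l⁻¹ * weightEnergy μ.toMeasure φ η +
        ENNReal.ofReal (1 - l)⁻¹ * weightEnergy ν.toMeasure φ' η' := by
  rw [concatFlow, concatWeight, LddmmFR.weightEnergy_concat hl hl1,
    h.weightEnergy_pullback hν fun t ht => h'.isDiffeo ht]

theorem concat (hl : 0 < l) (hl1 : l < 1) (h : Admissible F μ v φ η)
    (hν : ν.toMeasure = transformed μ φ η 1) (h' : Admissible F ν v' φ' η') :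
    Admissible F μ (concatField l v v') (concatFlow l φ φ') (concatWeight l φ η η') where
  memLp_field := memLp_concatField hl hl1 h.memLp_field h'.memLp_field
  isFlow := h.isFlow.concat hl hl1 h'.isFlow h.integrable_field h'.integrable_field
  memLp_weight := by
    rw [(h.isFlow.concat hl hl1 h'.isFlow h.integrable_field h'.integrable_field).memLp_weight_iff
      ((memLp_concatField hl hl1 h.memLp_field h'.memLp_field).integrable one_le_two)
      (h.aestronglyMeasurable_concatWeight hl hl1 hν h'), h.weightEnergy_concat hl hl1 hν h']
    exact ENNReal.add_lt_top.2 ⟨ENNReal.mul_lt_top ENNReal.ofReal_lt_top h.weightEnergy_lt_top,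
      ENNReal.mul_lt_top ENNReal.ofReal_lt_top h'.weightEnergy_lt_top⟩
  pos := by
    filter_upwards [h.pos, (h.ae_weight_iff hν).1 h'.pos, h.sqrtWeight_concat hl hl1 hν h']
      with x hx hx' hs t ht
    rw [hs t ht]
    exact forall_concat (P := (0 < ·)) hl hl1 hx
      (fun s hs' => mul_pos (hx 1 (by simp)) (hx' s hs')) t ht

theorem transformed_concat (hl : 0 < l) (hl1 : l < 1) (h : Admissible F μ v φ η)
    (hν : ν.toMeasure = transformed μ φ η 1) (h' : Admissible F ν v' φ' η') :
    transformed μ (concatFlow l φ φ') (concatWeight l φ η η') 1 = transformed ν φ' η' 1 := by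
  rw [transformed, transformed, concatFlow, concat_one hl1]
  refine (h.rescale_pushforward hν h'.isDiffeo_one h'.aemeasurable_sqrtWeight ?_).symm
  filter_upwards [h.sqrtWeight_concat hl hl1 hν h'] with x hx
  rw [hx 1 (by simp), concat_one hl1]

theorem energy_concat (hl : 0 < l) (hl1 : l < 1) (h : Admissible F μ v φ η)
    (hν : ν.toMeasure = transformed μ φ η 1) (h' : Admissible F ν v' φ' η') :
    energy γ μ (concatField l v v') (concatFlow l φ φ') (concatWeight l φ η η') =
      ENNReal.ofReal l⁻¹ * energy γ μ v φ η + ENNReal.ofReal (1 - l)⁻¹ * energy γ ν v' φ' η' := by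
  have hadm := h.concat hl hl1 hν h'
  rw [h.isFlow.energy_eq h.integrable_field, h'.isFlow.energy_eq h'.integrable_field,
    hadm.isFlow.energy_eq hadm.integrable_field, h.weightEnergy_concat hl hl1 hν h',
    lintegral_concatField hl hl1]
  ring

end Admissible

theorem Joins.trans {c c' : ℝ≥0∞} (hl : 0 < l) (hl1 : l < 1) (hj : Joins F γ μ ν c)
    (hj' : Joins F γ ν ρ c') :
    Joins F γ μ ρ (ENNReal.ofReal l⁻¹ * c + ENNReal.ofReal (1 - l)⁻¹ * c') := by
  obtain ⟨v, φ, η, h, hν, rfl⟩ := hj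
  obtain ⟨v', φ', η', h', hρ, rfl⟩ := hj'
  exact ⟨_, _, _, h.concat hl hl1 hν h', hρ.trans (h.transformed_concat hl hl1 hν h').symm,
    (h.energy_concat hl hl1 hν h').symm⟩

end Paths

/-! ### Separation -/

section LowerSemicontinuity

-- Fatou's lemma: on `O`, the indicator of `T i ⁻¹' O` is eventually `1` at almost every point.
theorem measure_le_liminf_map_withDensity {X : Type*} [TopologicalSpace X] [MeasurableSpace X]
    [OpensMeasurableSpace X] {m : Measure X} {T : ℕ → X → X} {w : ℕ → X → ℝ≥0∞}
    (hT : ∀ i, Measurable (T i)) (hw : ∀ i, AEMeasurable (w i) m)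
    (hTx : ∀ᵐ x ∂m, Tendsto (fun i => T i x) atTop (𝓝 x))
    (hwx : ∀ᵐ x ∂m, Tendsto (fun i => w i x) atTop (𝓝 1)) {O : Set X} (hO : IsOpen O) :
    m O ≤ liminf (fun i => (m.withDensity (w i)).map (T i) O) atTop := by
  have hOi (i : ℕ) : MeasurableSet (T i ⁻¹' O) := hT i hO.measurableSet
  calc m O = ∫⁻ x, O.indicator 1 x ∂m := (lintegral_indicator_one hO.measurableSet).symm
    _ ≤ ∫⁻ x, liminf (fun i => (T i ⁻¹' O).indicator (w i) x) atTop ∂m := by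
        refine lintegral_mono_ae ?_
        filter_upwards [hTx, hwx] with x hTx hwx
        refine indicator_apply_le' (fun hx => ?_) fun _ => zero_le
        refine (Tendsto.liminf_eq (hwx.congr' ?_)).ge
        filter_upwards [hTx.eventually (hO.mem_nhds hx)] with i hi
        exact (indicator_of_mem (s := T i ⁻¹' O) hi _).symm
    _ ≤ liminf (fun i => ∫⁻ x, (T i ⁻¹' O).indicator (w i) x ∂m) atTop :=
        lintegral_liminf_le' fun i => (hw i).indicator (hOi i)
    _ = _ := by
        simp only [Measure.map_apply (hT _) hO.measurableSet, withDensity_apply _ (hOi _),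
          lintegral_indicator (hOi _)]

variable {ι : Type*} {l : Filter ι}

theorem tendsto_zero_of_le_const_mul {f g : ι → ℝ≥0∞} {c : ℝ≥0∞} (hc : c ≠ ⊤)
    (hfg : ∀ i, f i ≤ c * g i) (hg : Tendsto g l (𝓝 0)) : Tendsto f l (𝓝 0) := by
  have hcg : Tendsto (fun i => c * g i) l (𝓝 0) := by
    simpa only [mul_zero] using ENNReal.Tendsto.const_mul hg (Or.inr hc)
  exact tendsto_of_tendsto_of_tendsto_of_le_of_le tendsto_const_nhds hcg (fun _ => zero_le) hfg

theorem tendsto_zero_of_tendsto_ofReal_sq {a : ι → ℝ}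
    (h : Tendsto (fun i => ENNReal.ofReal (a i ^ 2)) l (𝓝 0)) : Tendsto a l (𝓝 0) := by
  have hsq : Tendsto (fun i => a i ^ 2) l (𝓝 0) := by
    simpa [Function.comp_def, ENNReal.toReal_ofReal, sq_nonneg] using
      (ENNReal.tendsto_toReal ENNReal.zero_ne_top).comp h
  have hsqrt := (Real.continuous_sqrt.tendsto 0).comp hsq
  simp only [Function.comp_def, Real.sqrt_sq_eq_abs, Real.sqrt_zero] at hsqrt
  exact (tendsto_zero_iff_abs_tendsto_zero _).2 hsqrt

end LowerSemicontinuity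

section Separation

variable {n d : ℕ} {V : Type*} [NormedAddCommGroup V] [InnerProductSpace ℝ V]
  {F : FieldSpace n V} {γ : ℝ} {μ ν : Varifold n d}

namespace Admissible

variable {v : ℝ → V} {φ : ℝ → E n → E n} {η : ℝ → E n → ℝ}

theorem ofReal_sq_flowConst_le (h : Admissible F μ v φ η) (γ : ℝ) :
    ENNReal.ofReal (flowConst F v ^ 2) ≤
      ENNReal.ofReal (F.embConst ^ 2 * 2) * energy γ μ v φ η := by
  calc ENNReal.ofReal (flowConst F v ^ 2)
      ≤ ENNReal.ofReal (F.embConst ^ 2) * ∫⁻ t, ENNReal.ofReal (‖v t‖ ^ 2) ∂unitTime := by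
        rw [flowConst, mul_pow, ENNReal.ofReal_mul (sq_nonneg _), integral_unitTime]
        gcongr
        simpa using ofReal_sq_norm_integral_le h.memLp_field.1.norm
    _ = ENNReal.ofReal (F.embConst ^ 2 * 2) *
          (ENNReal.ofReal (1 / 2) * ∫⁻ t, ENNReal.ofReal (‖v t‖ ^ 2) ∂unitTime) := by
        rw [← mul_assoc, ← ENNReal.ofReal_mul (by positivity), mul_assoc,
          mul_one_div_cancel two_ne_zero, mul_one]
    _ ≤ _ := by
        rw [energy]
        gcongr
        exact le_self_add

theorem weightEnergy_le_energy (h : Admissible F μ v φ η) (hγ : 0 < γ) :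
    weightEnergy μ.toMeasure φ η ≤ ENNReal.ofReal (2 / γ) * energy γ μ v φ η := by
  calc weightEnergy μ.toMeasure φ η
      = ENNReal.ofReal (2 / γ) * (ENNReal.ofReal (γ / 2) * weightEnergy μ.toMeasure φ η) := by
        rw [← mul_assoc, ← ENNReal.ofReal_mul (by positivity), div_mul_div_cancel₀ hγ.ne',
          div_self two_ne_zero, ENNReal.ofReal_one, one_mul]
    _ ≤ _ := by
        rw [h.isFlow.energy_eq h.integrable_field]
        gcongr
        exact le_add_self

theorem lintegral_sqrtWeight_sub_one_le (h : Admissible F μ v φ η) :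
    ∫⁻ x, ENNReal.ofReal (‖sqrtWeight η 1 x - 1‖ ^ 2) ∂weight μ.toMeasure ≤
      ENNReal.ofReal (jacobianBound d (Real.exp (flowConst F v))) *
        weightEnergy μ.toMeasure φ η := by
  refine le_trans ?_ (h.isFlow.le_weightEnergy h.integrable_field)
  rw [lintegral_lintegral_swap (h.memLp_weight.1.aemeasurable.pow_const 2).ennreal_ofReal]
  refine lintegral_mono_ae ?_
  filter_upwards [h.ae_integrable] with x hx
  have hint := ofReal_sq_norm_integral_le hx.1
  simp only [Real.norm_eq_abs, sq_abs] at hint ⊢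
  refine le_trans (ENNReal.ofReal_le_ofReal ?_) hint
  rw [sqrtWeight, integral_unitTime]
  nlinarith [sq_nonneg (∫ s, η s x ∂unitTime)]

theorem aemeasurable_sqrtWeight_fst (h : Admissible F μ v φ η) :
    AEMeasurable (fun p : E n × OrientedGrassmannian n d => ENNReal.ofReal (sqrtWeight η 1 p.1 ^ 2))
      μ.toMeasure :=
  ((h.aemeasurable_sqrtWeight.pow_const 2).comp_measurable measurable_fst).ennreal_ofReal

theorem transformed_eq_map_withDensity (h : Admissible F μ v φ η) :
    transformed μ φ η 1 = (μ.toMeasure.withDensity fun p =>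
      ENNReal.ofReal (sqrtWeight η 1 p.1 ^ 2) * pushDensity (φ 1) p).map (pushMap (φ 1)) := by
  rw [h.transformed_eq, pushforward_eq, rescale, ← withDensity_mul₀ h.aemeasurable_sqrtWeight_fst
    h.isDiffeo_one.measurable_pushDensity.aemeasurable]
  rfl

section Limits

variable {ι : Type*} {l : Filter ι} {v : ι → ℝ → V} {φ : ι → ℝ → E n → E n}
  {η : ι → ℝ → E n → ℝ}

theorem tendsto_flowConst (h : ∀ i, Admissible F μ (v i) (φ i) (η i))
    (hE : Tendsto (fun i => energy γ μ (v i) (φ i) (η i)) l (𝓝 0)) :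
    Tendsto (fun i => flowConst F (v i)) l (𝓝 0) :=
  tendsto_zero_of_tendsto_ofReal_sq <| tendsto_zero_of_le_const_mul ENNReal.ofReal_ne_top
    (fun i => (h i).ofReal_sq_flowConst_le γ) hE

theorem tendsto_eLpNorm_sqrtWeight_sub_one (hγ : 0 < γ)
    (h : ∀ i, Admissible F μ (v i) (φ i) (η i))
    (hE : Tendsto (fun i => energy γ μ (v i) (φ i) (η i)) l (𝓝 0)) :
    Tendsto (fun i => eLpNorm (sqrtWeight (η i) 1 - 1) 2 (weight μ.toMeasure)) l (𝓝 0) := by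
  have hJ : Continuous fun κ : ℝ => ENNReal.ofReal (jacobianBound d (Real.exp κ)) := by
    unfold jacobianBound
    exact ENNReal.continuous_ofReal.comp (by fun_prop)
  have hbound := ENNReal.Tendsto.mul ((hJ.tendsto 0).comp (tendsto_flowConst h hE))
    (Or.inr ENNReal.zero_ne_top)
    (tendsto_zero_of_le_const_mul ENNReal.ofReal_ne_top
      (fun i => (h i).weightEnergy_le_energy hγ) hE) (Or.inr ENNReal.ofReal_ne_top)
  rw [mul_zero] at hbound
  have hsq := tendsto_of_tendsto_of_tendsto_of_le_of_le tendsto_const_nhds hbound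
    (fun _ => zero_le) fun i => (h i).lintegral_sqrtWeight_sub_one_le
  have hroot := ((ENNReal.continuous_rpow_const (y := 1 / 2)).tendsto 0).comp hsq
  rw [ENNReal.zero_rpow_of_pos (by norm_num)] at hroot
  simp only [eLpNorm_two_eq]
  exact hroot

theorem tendsto_apply (h : ∀ i, Admissible F μ (v i) (φ i) (η i))
    (hE : Tendsto (fun i => energy γ μ (v i) (φ i) (η i)) l (𝓝 0)) (x : E n) :
    Tendsto (fun i => φ i 1 x) l (𝓝 x) := by
  rw [tendsto_iff_norm_sub_tendsto_zero]
  exact squeeze_zero (fun _ => norm_nonneg _)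
    (fun i => (h i).isFlow.norm_apply_sub_le (h i).integrable_field (by simp) x)
    (tendsto_flowConst h hE)

theorem tendsto_fderiv (h : ∀ i, Admissible F μ (v i) (φ i) (η i))
    (hE : Tendsto (fun i => energy γ μ (v i) (φ i) (η i)) l (𝓝 0)) (x : E n) :
    Tendsto (fun i => fderiv ℝ (φ i 1) x) l (𝓝 (ContinuousLinearMap.id ℝ (E n))) := by
  rw [tendsto_iff_norm_sub_tendsto_zero]
  have hexp := ((Real.continuous_exp.tendsto 0).comp (tendsto_flowConst h hE)).sub_const 1
  rw [Real.exp_zero, sub_self] at hexp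
  exact squeeze_zero (fun _ => norm_nonneg _)
    (fun i => (h i).isFlow.norm_fderiv_sub_id_le (h i).integrable_field (by simp) x) hexp

theorem tendsto_pushMap (h : ∀ i, Admissible F μ (v i) (φ i) (η i))
    (hE : Tendsto (fun i => energy γ μ (v i) (φ i) (η i)) l (𝓝 0))
    (p : E n × OrientedGrassmannian n d) : Tendsto (fun i => pushMap (φ i 1) p) l (𝓝 p) := by
  have htransport := tendsto_transport (tendsto_fderiv h hE p.1)
    (fun i => (h i).isDiffeo_one.injective_fderiv _) Function.injective_id p.2
  rw [transport_id] at htransport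
  exact (tendsto_apply h hE p.1).prodMk_nhds htransport

theorem tendsto_pushDensity (h : ∀ i, Admissible F μ (v i) (φ i) (η i))
    (hE : Tendsto (fun i => energy γ μ (v i) (φ i) (η i)) l (𝓝 0))
    (p : E n × OrientedGrassmannian n d) : Tendsto (fun i => pushDensity (φ i 1) p) l (𝓝 1) := by
  have hjacobian := tendsto_jacobian (tendsto_fderiv h hE p.1) p.2
  rw [jacobian_id] at hjacobian
  simpa only [pushDensity, ENNReal.ofReal_one] using ENNReal.tendsto_ofReal hjacobian

end Limits

theorem exists_seq_tendsto_sqrtWeight {v : ℕ → ℝ → V} {φ : ℕ → ℝ → E n → E n}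
    {η : ℕ → ℝ → E n → ℝ} (hγ : 0 < γ) (h : ∀ k, Admissible F μ (v k) (φ k) (η k))
    (hE : Tendsto (fun k => energy γ μ (v k) (φ k) (η k)) atTop (𝓝 0)) :
    ∃ k : ℕ → ℕ, StrictMono k ∧ ∀ᵐ p ∂μ.toMeasure,
      Tendsto (fun i => sqrtWeight (η (k i)) 1 p.1) atTop (𝓝 1) := by
  obtain ⟨k, hk, hae⟩ := (tendstoInMeasure_of_tendsto_eLpNorm two_ne_zero
    (fun k => (h k).aemeasurable_sqrtWeight.aestronglyMeasurable) aestronglyMeasurable_one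
    (tendsto_eLpNorm_sqrtWeight_sub_one hγ h hE)).exists_seq_tendsto_ae
  exact ⟨k, hk, ae_of_ae_map measurable_fst.aemeasurable hae⟩

end Admissible

namespace Joins

theorem measure_le_of_isOpen (hγ : 0 < γ) (h : sInf {c | Joins F γ μ ν c} = 0)
    {O : Set (E n × OrientedGrassmannian n d)} (hO : IsOpen O) :
    μ.toMeasure O ≤ ν.toMeasure O := by
  have hne : {c | Joins F γ μ ν c}.Nonempty := by
    by_contra hempty
    simp [not_nonempty_iff_eq_empty.1 hempty] at h
  obtain ⟨c, -, hc, hjoins⟩ := exists_seq_tendsto_sInf hne (OrderBot.bddBelow _)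
  choose v φ η hadm hν henergy using hjoins
  rw [h, funext henergy] at hc
  obtain ⟨k, hk, hweight⟩ := Admissible.exists_seq_tendsto_sqrtWeight hγ hadm hc
  have hsub := hc.comp hk.tendsto_atTop
  calc μ.toMeasure O ≤ liminf (fun i => (μ.toMeasure.withDensity fun p =>
        ENNReal.ofReal (sqrtWeight (η (k i)) 1 p.1 ^ 2) * pushDensity (φ (k i) 1) p).map
          (pushMap (φ (k i) 1)) O) atTop := by
        refine measure_le_liminf_map_withDensity (fun i => (hadm _).isDiffeo_one.measurable_pushMap)
          (fun i => (hadm _).aemeasurable_sqrtWeight_fst.mul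
            (hadm _).isDiffeo_one.measurable_pushDensity.aemeasurable)
          (.of_forall (Admissible.tendsto_pushMap (fun i => hadm (k i)) hsub))
          (hweight.mono fun p hp => ?_) hO
        simpa using ENNReal.Tendsto.mul (ENNReal.tendsto_ofReal (hp.pow 2))
          (Or.inr ENNReal.one_ne_top)
          (Admissible.tendsto_pushDensity (fun i => hadm (k i)) hsub p)
          (Or.inr ENNReal.ofReal_ne_top)
    _ = ν.toMeasure O := by
        simp only [← (hadm _).transformed_eq_map_withDensity, ← hν, liminf_const]

theorem sInf_symm (F : FieldSpace n V) (γ : ℝ) (μ ν : Varifold n d) :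
    sInf {c | Joins F γ μ ν c} = sInf {c | Joins F γ ν μ c} :=
  congrArg sInf (Set.ext fun _ => ⟨Joins.symm, Joins.symm⟩)

theorem eq_of_sInf_eq_zero (hγ : 0 < γ) (h : sInf {c | Joins F γ μ ν c} = 0) : μ = ν := by
  have hopen (O : Set (E n × OrientedGrassmannian n d)) (hO : IsOpen O) :
      μ.toMeasure O = ν.toMeasure O :=
    le_antisymm (measure_le_of_isOpen hγ h hO)
      (measure_le_of_isOpen hγ ((sInf_symm F γ ν μ).trans h) hO)
  have hmeasure : μ.toMeasure = ν.toMeasure := ext_of_generate_finite {O | IsOpen O}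
    BorelSpace.measurable_eq isPiSystem_isOpen hopen (hopen univ isOpen_univ)
  exact Subtype.ext hmeasure

end Joins

end Separation

/-! ### The distance -/

section Distance

variable {n d : ℕ} {V : Type*} [NormedAddCommGroup V] [InnerProductSpace ℝ V]
  {F : FieldSpace n V} {γ : ℝ} {μ ν ρ : Varifold n d}

theorem distFR_eq (F : FieldSpace n V) (γ : ℝ) (μ ν : Varifold n d) :
    distFR F γ μ ν = sInf {c | Joins F γ μ ν c} ^ (1 / 2 : ℝ) := rfl

theorem Joins.distFR_le {c : ℝ≥0∞} (h : Joins F γ μ ν c) : distFR F γ μ ν ≤ c ^ (1 / 2 : ℝ) :=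
  ENNReal.rpow_le_rpow (sInf_le h) (by norm_num)

theorem Joins.distFR_ne_top {c : ℝ≥0∞} (h : Joins F γ μ ν c) : distFR F γ μ ν ≠ ⊤ := by
  refine ne_top_of_le_ne_top (ENNReal.rpow_ne_top_of_nonneg (by norm_num) ?_) h.distFR_le
  obtain ⟨v, φ, η, h, -, rfl⟩ := h
  exact h.energy_ne_top γ

theorem exists_joins_of_mem_orbit (γ : ℝ) (h : ν ∈ orbit F μ) : ∃ c, Joins F γ μ ν c := by
  obtain ⟨v, φ, η, h, hν⟩ := h
  exact ⟨_, v, φ, η, h, hν, rfl⟩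

theorem distFR_ne_top (hμ : μ ∈ orbit F ρ) (hν : ν ∈ orbit F ρ) : distFR F γ μ ν ≠ ⊤ := by
  obtain ⟨c, hc⟩ := exists_joins_of_mem_orbit γ hμ
  obtain ⟨c', hc'⟩ := exists_joins_of_mem_orbit γ hν
  exact (hc.symm.trans one_half_pos one_half_lt_one hc').distFR_ne_top

theorem distFR_comm (F : FieldSpace n V) (γ : ℝ) (μ ν : Varifold n d) :
    distFR F γ μ ν = distFR F γ ν μ := by
  rw [distFR_eq, distFR_eq, Joins.sInf_symm]

theorem exists_joins_lt_of_distFR_lt {A : ℝ≥0∞} (h : distFR F γ μ ν < A) :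
    ∃ c < A ^ 2, Joins F γ μ ν c := by
  rw [distFR_eq, one_div, ENNReal.rpow_inv_lt_iff two_pos, ENNReal.rpow_ofNat, sInf_lt_iff] at h
  obtain ⟨c, hc, hcA⟩ := h
  exact ⟨c, hcA, hc⟩

-- Running the two paths during times proportional to `A` and `B` turns `A²` and `B²` into
-- `(A + B) A` and `(A + B) B`.
theorem Joins.distFR_le_add {A B : ℝ} (hA : 0 < A) (hB : 0 < B) {c c' : ℝ≥0∞}
    (h : Joins F γ μ ν c) (h' : Joins F γ ν ρ c') (hc : c ≤ ENNReal.ofReal A ^ 2)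
    (hc' : c' ≤ ENNReal.ofReal B ^ 2) : distFR F γ μ ρ ≤ ENNReal.ofReal (A + B) := by
  have hAB : 0 < A + B := add_pos hA hB
  have hB' : 1 - A / (A + B) = B / (A + B) := by field_simp; ring
  have hjoins := h.trans (div_pos hA hAB) ((div_lt_one hAB).2 (by linarith)) h'
  rw [hB', inv_div, inv_div] at hjoins
  calc distFR F γ μ ρ
      ≤ (ENNReal.ofReal ((A + B) / A) * c + ENNReal.ofReal ((A + B) / B) * c') ^ (1 / 2 : ℝ) :=
        hjoins.distFR_le
    _ ≤ (ENNReal.ofReal ((A + B) / A) * ENNReal.ofReal A ^ 2 +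
          ENNReal.ofReal ((A + B) / B) * ENNReal.ofReal B ^ 2) ^ (1 / 2 : ℝ) := by gcongr
    _ = (ENNReal.ofReal (A + B) ^ 2) ^ (1 / 2 : ℝ) := by
        rw [← ENNReal.ofReal_pow hA.le, ← ENNReal.ofReal_pow hB.le, ← ENNReal.ofReal_pow hAB.le,
          ← ENNReal.ofReal_mul (by positivity), ← ENNReal.ofReal_mul (by positivity),
          ← ENNReal.ofReal_add (by positivity) (by positivity)]
        congr 2
        field_simp
    _ = ENNReal.ofReal (A + B) := by
        rw [← ENNReal.rpow_ofNat, ← ENNReal.rpow_mul]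
        norm_num

theorem distFR_triangle (F : FieldSpace n V) (γ : ℝ) (μ ν ρ : Varifold n d) :
    distFR F γ μ ρ ≤ distFR F γ μ ν + distFR F γ ν ρ := by
  refine ENNReal.le_of_forall_pos_le_add fun ε hε hlt => ?_
  obtain ⟨ha, hb⟩ := ENNReal.add_ne_top.1 hlt.ne
  have hε' : (0 : ℝ) < ε := hε
  set a : ℝ := (distFR F γ μ ν).toReal
  set b : ℝ := (distFR F γ ν ρ).toReal
  have ha0 : 0 ≤ a := ENNReal.toReal_nonneg
  have hb0 : 0 ≤ b := ENNReal.toReal_nonneg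
  obtain ⟨c, hc, h⟩ := exists_joins_lt_of_distFR_lt
    ((ENNReal.lt_ofReal_iff_toReal_lt ha).2 (lt_add_of_pos_right a (half_pos hε')))
  obtain ⟨c', hc', h'⟩ := exists_joins_lt_of_distFR_lt
    ((ENNReal.lt_ofReal_iff_toReal_lt hb).2 (lt_add_of_pos_right b (half_pos hε')))
  calc distFR F γ μ ρ ≤ ENNReal.ofReal (a + ε / 2 + (b + ε / 2)) :=
        h.distFR_le_add (by positivity) (by positivity) h' hc.le hc'.le
    _ = ENNReal.ofReal (a + b + ε) := by
        congr 1
        ring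
    _ = distFR F γ μ ν + distFR F γ ν ρ + ε := by
        rw [ENNReal.ofReal_add (add_nonneg ha0 hb0) hε'.le, ENNReal.ofReal_add ha0 hb0,
          ENNReal.ofReal_toReal ha, ENNReal.ofReal_toReal hb, ENNReal.ofReal_coe_nnreal]

theorem distFR_eq_zero_iff (hγ : 0 < γ) : distFR F γ μ ν = 0 ↔ μ = ν := by
  rw [distFR_eq, ENNReal.rpow_eq_zero_iff_of_pos (by norm_num)]
  refine ⟨Joins.eq_of_sInf_eq_zero hγ, ?_⟩
  rintro rfl
  exact le_antisymm (sInf_le (Joins.refl F γ μ)) zero_le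

end Distance

end LddmmFR

end

theorem theorem1_general {n d : ℕ} {V : Type*} [NormedAddCommGroup V] [InnerProductSpace ℝ V]
    (F : LddmmFR.FieldSpace n V) {γ : ℝ} (hγ : 0 < γ) :
    (∀ μ₀ : LddmmFR.Varifold n d, ∀ μ ∈ LddmmFR.orbit F μ₀, ∀ ν ∈ LddmmFR.orbit F μ₀,
      LddmmFR.distFR F γ μ ν ≠ ⊤) ∧
    (∀ μ ν : LddmmFR.Varifold n d, LddmmFR.distFR F γ μ ν = LddmmFR.distFR F γ ν μ) ∧
    (∀ μ ν ρ : LddmmFR.Varifold n d,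
      LddmmFR.distFR F γ μ ρ ≤ LddmmFR.distFR F γ μ ν + LddmmFR.distFR F γ ν ρ) ∧
    (∀ μ ν : LddmmFR.Varifold n d, LddmmFR.distFR F γ μ ν = 0 ↔ μ = ν) :=
  ⟨fun _ _ hμ _ hν => LddmmFR.distFR_ne_top hμ hν, LddmmFR.distFR_comm F γ,
    LddmmFR.distFR_triangle F γ, fun _ _ => LddmmFR.distFR_eq_zero_iff hγ⟩

theorem theorem1 {n d : ℕ} (hn : 2 ≤ n) (hd : d ≤ n)
    {V : Type*} [NormedAddCommGroup V] [InnerProductSpace ℝ V] [CompleteSpace V]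
    (F : LddmmFR.FieldSpace n V) {γ : ℝ} (hγ : 0 < γ) (μ₀ : LddmmFR.Varifold n d) :
    (∀ μ ∈ LddmmFR.orbit F μ₀, ∀ ν ∈ LddmmFR.orbit F μ₀, LddmmFR.distFR F γ μ ν ≠ ⊤) ∧
    (∀ μ ∈ LddmmFR.orbit F μ₀, ∀ ν ∈ LddmmFR.orbit F μ₀,
      LddmmFR.distFR F γ μ ν = LddmmFR.distFR F γ ν μ) ∧
    (∀ μ ∈ LddmmFR.orbit F μ₀, ∀ ν ∈ LddmmFR.orbit F μ₀, ∀ ρ ∈ LddmmFR.orbit F μ₀,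
      LddmmFR.distFR F γ μ ρ ≤ LddmmFR.distFR F γ μ ν + LddmmFR.distFR F γ ν ρ) ∧
    (∀ μ ∈ LddmmFR.orbit F μ₀, ∀ ν ∈ LddmmFR.orbit F μ₀,
      LddmmFR.distFR F γ μ ν = 0 ↔ μ = ν) :=
  let ⟨hfinite, hcomm, htriangle, hzero⟩ := theorem1_general F hγ
  ⟨hfinite μ₀, fun μ _ ν _ => hcomm μ ν, fun μ _ ν _ ρ _ => htriangle μ ν ρ,
    fun μ _ ν _ => hzero μ ν⟩
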